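/- Let $\mathcal C$ be a braided monoidal category with tensor product $\otimes$, unit object $K$ and braiding $c$, in which every idempotent splits and all coequalizers exist (associativity and unit isomorphisms are suppressed below, and an object also denotes its identity morphism). A weak Hopf quasigroup in $\mathcal C$ is an object $H$ with morphisms $\eta:K\to H$, $\mu:H\otimes H\to H$ satisfying $\mu\circ(H\otimes\eta)=id_H=\mu\circ(\eta\otimes H)$ ($\mu$ need not be associative), a (coassociative, counital) comonoid structure $(\varepsilon,\delta)$ and a morphism $\lambda:H\to H$ (the antipode) such that, writing $f*g=\mu\circ(f\otimes g)\circ\delta$, $\Pi^L=id_H*\lambda$ and $\Pi^R=\lambda*id_H$: (a1) $\delta\circ\mu=(\mu\otimes\mu)\circ(H\otimes c_{H,H}\otimes H)\circ(\delta\otimes\delta)$; (a2) $\varepsilon\mu(\mu\otimes H)=\varepsilon\mu(H\otimes\mu)=(\varepsilon\mu\otimes\varepsilon\mu)(H\otimes\delta\otimes H)=(\varepsilon\mu\otimes\varepsilon\mu)(H\otimes(c_{H,H}^{-1}\delta)\otimes H)$; (a3) $(\delta\otimes H)\delta\eta=(H\otimes\mu\otimes H)(\delta\eta\otimes\delta\eta)=(H\otimes(\mu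 c_{H,H}^{-1})\otimes H)(\delta\eta\otimes\delta\eta)$; (a4) $\Pi^L=(\varepsilon\mu\otimes H)(H\otimes c_{H,H})(\delta\eta\otimes H)$; $\ \Pi^R=(H\otimes\varepsilon\mu)(c_{H,H}\otimes H)(H\otimes\delta\eta)$; $\ \lambda*\Pi^L=\lambda=\Pi^R*\lambda$; $\ \mu(\lambda\otimes\mu)(\delta\otimes H)=\mu(\Pi^R\otimes H)$; $\ \mu(H\otimes\mu)(H\otimes\lambda\otimes H)(\delta\otimes H)=\mu(\Pi^L\otimes H)$; $\ \mu(\mu\otimes\lambda)(H\otimes\delta)=\mu(H\otimes\Pi^L)$; $\ \mu(\mu\otimes H)(H\otimes\lambda\otimes H)(H\otimes\delta)=\mu(H\otimes\Pi^R)$. Write the idempotent $\Pi^L$ as $i_L\circ p_L$ with $p_L\circ i_L=id_{H_L}$, where $p_L:H\to H_L$, $i_L:H_L\to H$. Then $H_L$ is a monoid with unit $p_L\eta$ and product $p_L\mu(i_L\otimes i_L)$; let $\mathcal C_{H_L}$ be the category of right $H_L$-modules $(N,\psi_N)$ in $\mathcal C$. A right-right $H$-Hopf module is an object $M$ with a right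 $H$-comodule structure $\rho_M:M\to M\otimes H$ and a morphism $\phi_M:M\otimes H\to M$ such that $\phi_M(M\otimes\eta)=id_M$; $\rho_M\phi_M=(\phi_M\otimes\mu)(M\otimes c_{H,H}\otimes H)(\rho_M\otimes\delta)$; $\phi_M(\phi_M\otimes\lambda)(M\otimes\delta)=\phi_M(M\otimes\Pi^L)$; $\phi_M(\phi_M\otimes H)(M\otimes\lambda\otimes H)(M\otimes\delta)=\phi_M(M\otimes\Pi^R)$; and $\phi_M(\phi_M\otimes H)(M\otimes\Pi^L\otimes H)(M\otimes\delta)=\phi_M$. The object of coinvariants $M^{coH}$ is the image of the idempotent $q_M=\phi_M(M\otimes\lambda)\rho_M$, with $q_M=i_Mp_M$, $p_Mi_M=id_{M^{coH}}$. Put $\omega_M=\phi_M(i_M\otimes H)$, $\omega'_M=(p_M\otimes H)\rho_M$, let $M^{coH}\times H$ be the image of the idempotent $\nabla_M=\omega'_M\omega_M$ of $M^{coH}\otimes H$, with $\nabla_M=\iota_M\pi_M$, $\pi_M\iota_M=id$, and let $\alpha_M=\pi_M\omega'_M:M\to M^{coH}\times H$, an isomorphism with inverse $\omega_M\iota_M$.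 With $\phi_{M^{coH}\times H}=\pi_M(M^{coH}\otimes\mu)(\iota_M\otimes H)$ put $\phi_M^{\alpha_M}=\alpha_M^{-1}\circ\phi_{M^{coH}\times H}\circ(\alpha_M\otimes H)$. A morphism of Hopf modules $f:M\to N$ is a morphism of right $H$-comodules with $\phi_N^{\alpha_N}\circ(f\otimes H)=f\circ\phi_M^{\alpha_M}$. The category $\mathcal{SM}^H_H$ of strong Hopf modules is the full subcategory of the resulting category on those $M$ with $\phi_M\circ((\phi_M\circ(M\otimes i_L))\otimes H)=\phi_M\circ(M\otimes(\mu\circ(i_L\otimes H)))$. **Theorem.** Let $H$ be a weak Hopf quasigroup in $\mathcal C$ such that the functor $-\otimes H$ preserves coequalizers. Then $\mathcal{SM}^H_H$ is equivalent to $\mathcal C_{H_L}$. More precisely, there are the following functors $F$ and $G$, with $F$ left adjoint to $G$ and with unit and counit of the adjunction natural isomorphisms (so $F$ is an equivalence): - the induction functor $F=-\otimes_{H_L}H:\mathcal C_{H_L}\to\mathcal{SM}^H_H$, where $n_N:N\otimes H\to N\otimes_{H_L}H$ is a coequalizer of $\psi_N\otimes H$ and $N\otimes(\mu\circ(i_L\otimes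 H))$, the action and coaction are determined by $\phi\circ(n_N\otimes H)=n_N\circ(N\otimes\mu)$ and $\rho\circ n_N=(n_N\otimes H)\circ(N\otimes\delta)$, and $F(f)\circ n_N=n_P\circ(f\otimes H)$ for $f:N\to P$; - the functor of coinvariants $G=(-)^{coH}:\mathcal{SM}^H_H\to\mathcal C_{H_L}$, where $M^{coH}$ has the action $p_M\circ\phi_M\circ(i_M\otimes i_L)$, and $i_T\circ G(g)=g\circ i_M$ for $g:M\to T$. -/

import Mathlib

open CategoryTheory MonoidalCategory Limits
open scoped ComonObj

universe v u

noncomputable section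

section Splitting

variable {C : Type u} [Category.{v} C] [IsIdempotentComplete C]

theorem exists_image_factorization {Y : C} (e : Y ⟶ Y) :
    ∃ (Z : C) (p : Y ⟶ Z) (i : Z ⟶ Y), p ≫ i = e ∧ (e ≫ e = e → i ≫ p = 𝟙 Z) := by
  by_cases h : e ≫ e = e
  · obtain ⟨Z, i, p, h₁, h₂⟩ := IsIdempotentComplete.idempotents_split Y e h
    exact ⟨Z, p, i, h₂, fun _ => h₁⟩
  · exact ⟨Y, 𝟙 Y, e, Category.id_comp e, fun h' => absurd h' h⟩

/-- The image of an idempotent `e` (only used for idempotents). -/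
def idemImage {Y : C} (e : Y ⟶ Y) : C := (exists_image_factorization e).choose

/-- The projection of `Y` onto the image of an idempotent `e`. -/
def idemProj {Y : C} (e : Y ⟶ Y) : Y ⟶ idemImage e :=
  (exists_image_factorization e).choose_spec.choose

/-- The inclusion of the image of an idempotent `e` into `Y`. -/
def idemIncl {Y : C} (e : Y ⟶ Y) : idemImage e ⟶ Y :=
  (exists_image_factorization e).choose_spec.choose_spec.choose

theorem idemProj_comp_idemIncl {Y : C} (e : Y ⟶ Y) : idemProj e ≫ idemIncl e = e :=
  (exists_image_factorization e).choose_spec.choose_spec.choose_spec.1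

theorem idemIncl_comp_idemProj {Y : C} (e : Y ⟶ Y) (he : e ≫ e = e) :
    idemIncl e ≫ idemProj e = 𝟙 (idemImage e) :=
  (exists_image_factorization e).choose_spec.choose_spec.choose_spec.2 he

end Splitting

/-- The convolution product `f ∗ g = m ∘ (f ⊗ g) ∘ δ` of morphisms from a comonoid `D` to an
object `A` with a product `m`. -/
def convolutionProduct {C : Type u} [Category.{v} C] [MonoidalCategory C]
    {D A : C} [ComonObj D] (m : A ⊗ A ⟶ A) (f g : D ⟶ A) : D ⟶ A :=
  Δ[D] ≫ (f ⊗ₘ g) ≫ m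

/-- A weak Hopf quasigroup in a braided monoidal category: a comonoid with a compatible unital,
not necessarily associative, product and an antipode. -/
structure WeakHopfQuasigroup (C : Type u) [Category.{v} C] [MonoidalCategory C]
    [BraidedCategory C] extends Comon C where
  /-- the unit -/
  one : 𝟙_ C ⟶ X
  /-- the product -/
  mul : X ⊗ X ⟶ X
  /-- the antipode -/
  antipode : X ⟶ X
  one_mul : one ▷ X ≫ mul = (λ_ X).hom
  mul_one : X ◁ one ≫ mul = (ρ_ X).hom
  -- the coproduct is multiplicative
  mul_comul : mul ≫ Δ[X] = (Δ[X] ⊗ₘ Δ[X]) ≫ tensorμ X X X X ≫ (mul ⊗ₘ mul)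
  -- weak multiplicativity of the counit
  counit_mul_assoc :
    mul ▷ X ≫ mul ≫ ε[X] = (α_ X X X).hom ≫ X ◁ mul ≫ mul ≫ ε[X]
  counit_mul_mul :
    mul ▷ X ≫ mul ≫ ε[X] =
      (X ◁ Δ[X]) ▷ X ≫ (α_ X X X).inv ▷ X ≫ (α_ (X ⊗ X) X X).hom ≫
        ((mul ≫ ε[X]) ⊗ₘ (mul ≫ ε[X])) ≫ (λ_ (𝟙_ C)).hom
  counit_mul_mul_braiding :
    mul ▷ X ≫ mul ≫ ε[X] =
      (X ◁ (Δ[X] ≫ (β_ X X).inv)) ▷ X ≫ (α_ X X X).inv ▷ X ≫ (α_ (X ⊗ X) X X).hom ≫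
        ((mul ≫ ε[X]) ⊗ₘ (mul ≫ ε[X])) ≫ (λ_ (𝟙_ C)).hom
  -- weak comultiplicativity of the unit
  one_comul_comul :
    one ≫ Δ[X] ≫ Δ[X] ▷ X =
      (λ_ (𝟙_ C)).inv ≫ ((one ≫ Δ[X]) ⊗ₘ (one ≫ Δ[X])) ≫
        (α_ (X ⊗ X) X X).inv ≫ (α_ X X X).hom ▷ X ≫ (X ◁ mul) ▷ X
  one_comul_comul_braiding :
    one ≫ Δ[X] ≫ Δ[X] ▷ X =
      (λ_ (𝟙_ C)).inv ≫ ((one ≫ Δ[X]) ⊗ₘ (one ≫ Δ[X])) ≫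
        (α_ (X ⊗ X) X X).inv ≫ (α_ X X X).hom ▷ X ≫ (X ◁ ((β_ X X).inv ≫ mul)) ▷ X
  -- the target morphism `id ∗ antipode` and the source morphism `antipode ∗ id`
  target_eq :
    convolutionProduct mul (𝟙 X) antipode =
      (λ_ X).inv ≫ (one ≫ Δ[X]) ▷ X ≫ (α_ X X X).hom ≫ X ◁ (β_ X X).hom ≫
        (α_ X X X).inv ≫ (mul ≫ ε[X]) ▷ X ≫ (λ_ X).hom
  source_eq :
    convolutionProduct mul antipode (𝟙 X) =
      (ρ_ X).inv ≫ X ◁ (one ≫ Δ[X]) ≫ (α_ X X X).inv ≫ (β_ X X).hom ▷ X ≫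
        (α_ X X X).hom ≫ X ◁ (mul ≫ ε[X]) ≫ (ρ_ X).hom
  antipode_conv_target :
    convolutionProduct mul antipode (convolutionProduct mul (𝟙 X) antipode) = antipode
  source_conv_antipode :
    convolutionProduct mul (convolutionProduct mul antipode (𝟙 X)) antipode = antipode
  -- replacements for associativity
  antipode_mul_mul :
    Δ[X] ▷ X ≫ (α_ X X X).hom ≫ (antipode ⊗ₘ mul) ≫ mul =
      convolutionProduct mul antipode (𝟙 X) ▷ X ≫ mul
  mul_antipode_mul :
    Δ[X] ▷ X ≫ (α_ X X X).hom ≫ X ◁ (antipode ▷ X) ≫ X ◁ mul ≫ mul =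
      convolutionProduct mul (𝟙 X) antipode ▷ X ≫ mul
  mul_mul_antipode :
    X ◁ Δ[X] ≫ (α_ X X X).inv ≫ (mul ⊗ₘ antipode) ≫ mul =
      X ◁ convolutionProduct mul (𝟙 X) antipode ≫ mul
  mul_antipode_mul' :
    X ◁ Δ[X] ≫ (α_ X X X).inv ≫ (X ◁ antipode) ▷ X ≫ mul ▷ X ≫ mul =
      X ◁ convolutionProduct mul antipode (𝟙 X) ≫ mul

section

variable {C : Type u} [Category.{v} C] [MonoidalCategory C] [BraidedCategory C]

namespace WeakHopfQuasigroup

variable (H : WeakHopfQuasigroup C)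

/-- The target morphism `Π^L = id ∗ antipode`. -/
def PiL : H.X ⟶ H.X := convolutionProduct H.mul (𝟙 H.X) H.antipode

/-- The source morphism `Π^R = antipode ∗ id`. -/
def PiR : H.X ⟶ H.X := convolutionProduct H.mul H.antipode (𝟙 H.X)

variable [IsIdempotentComplete C]

/-- The object `H_L`, the image of the target morphism. -/
def HL : C := idemImage H.PiL

/-- The projection `p_L : H ⟶ H_L`. -/
def pL : H.X ⟶ H.HL := idemProj H.PiL

/-- The inclusion `i_L : H_L ⟶ H`. -/
def iL : H.HL ⟶ H.X := idemIncl H.PiL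

/-- The unit of `H_L`. -/
def oneL : 𝟙_ C ⟶ H.HL := H.one ≫ H.pL

/-- The product of `H_L`. -/
def mulL : H.HL ⊗ H.HL ⟶ H.HL := (H.iL ⊗ₘ H.iL) ≫ H.mul ≫ H.pL

/-- The morphism `μ_H ∘ (i_L ⊗ H)`, the left action of `H_L` on `H`. -/
def phiL : H.HL ⊗ H.X ⟶ H.X := H.iL ▷ H.X ≫ H.mul

end WeakHopfQuasigroup

/-- A right-right `H`-Hopf module. -/
structure HopfModule (H : WeakHopfQuasigroup C) where
  /-- the underlying object -/
  X : C
  /-- the action -/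
  act : X ⊗ H.X ⟶ X
  /-- the coaction -/
  coact : X ⟶ X ⊗ H.X
  coact_counit : coact ≫ X ◁ ε[H.X] = (ρ_ X).inv
  coact_coact : coact ≫ coact ▷ H.X = coact ≫ X ◁ Δ[H.X] ≫ (α_ X H.X H.X).inv
  act_one : X ◁ H.one ≫ act = (ρ_ X).hom
  act_coact : act ≫ coact =
    (coact ⊗ₘ Δ[H.X]) ≫ tensorμ X H.X H.X H.X ≫ (act ⊗ₘ H.mul)
  act_act_antipode :
    X ◁ Δ[H.X] ≫ (α_ X H.X H.X).inv ≫ (act ⊗ₘ H.antipode) ≫ act = X ◁ H.PiL ≫ act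
  act_antipode_act :
    X ◁ Δ[H.X] ≫ (α_ X H.X H.X).inv ≫ (X ◁ H.antipode) ▷ H.X ≫ act ▷ H.X ≫ act =
      X ◁ H.PiR ≫ act
  act_target_act :
    X ◁ Δ[H.X] ≫ (α_ X H.X H.X).inv ≫ (X ◁ H.PiL) ▷ H.X ≫ act ▷ H.X ≫ act = act

namespace HopfModule

variable {H : WeakHopfQuasigroup C}

/-- The morphism `q_M = φ_M ∘ (M ⊗ antipode) ∘ ρ_M`. -/
def q (M : HopfModule H) : M.X ⟶ M.X := M.coact ≫ M.X ◁ H.antipode ≫ M.act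

variable [IsIdempotentComplete C]

/-- The object of coinvariants `M^{co H}`, the image of `q_M`. -/
def coinv (M : HopfModule H) : C := idemImage M.q

/-- The projection `p_M : M ⟶ M^{co H}`. -/
def p (M : HopfModule H) : M.X ⟶ M.coinv := idemProj M.q

/-- The inclusion `i_M : M^{co H} ⟶ M`. -/
def i (M : HopfModule H) : M.coinv ⟶ M.X := idemIncl M.q

/-- `ω_M = φ_M ∘ (i_M ⊗ H)`. -/
def omega (M : HopfModule H) : M.coinv ⊗ H.X ⟶ M.X := M.i ▷ H.X ≫ M.act

/-- `ω'_M = (p_M ⊗ H) ∘ ρ_M`. -/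
def omega' (M : HopfModule H) : M.X ⟶ M.coinv ⊗ H.X := M.coact ≫ M.p ▷ H.X

/-- The idempotent `∇_M = (p_M ⊗ H) ∘ ρ_M ∘ φ_M ∘ (i_M ⊗ H)` of `M^{co H} ⊗ H`. -/
def nabla (M : HopfModule H) : M.coinv ⊗ H.X ⟶ M.coinv ⊗ H.X := M.omega ≫ M.omega'

/-- The object `M^{co H} × H`, the image of `∇_M`. -/
def coinvTimes (M : HopfModule H) : C := idemImage M.nabla

/-- The action of `H` on `M^{co H} × H`. -/
def coinvTimesAct (M : HopfModule H) : M.coinvTimes ⊗ H.X ⟶ M.coinvTimes :=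
  idemIncl M.nabla ▷ H.X ≫ (α_ M.coinv H.X H.X).hom ≫ M.coinv ◁ H.mul ≫ idemProj M.nabla

/-- The canonical isomorphism `α_M : M ⟶ M^{co H} × H`. -/
def alpha (M : HopfModule H) : M.X ⟶ M.coinvTimes := M.omega' ≫ idemProj M.nabla

/-- The inverse of `α_M`. -/
def alphaInv (M : HopfModule H) : M.coinvTimes ⟶ M.X := idemIncl M.nabla ≫ M.omega

/-- The action `φ_M^{α_M} = α_M⁻¹ ∘ φ_{M^{co H} × H} ∘ (α_M ⊗ H)`, transported along `α_M`. -/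
def actAlpha (M : HopfModule H) : M.X ⊗ H.X ⟶ M.X :=
  M.alpha ▷ H.X ≫ M.coinvTimesAct ≫ M.alphaInv

/-- Morphisms of Hopf modules: `H`-colinear and `H`-quasilinear morphisms. -/
@[ext]
structure Hom (M N : HopfModule H) where
  /-- the underlying morphism -/
  hom : M.X ⟶ N.X
  colinear : hom ≫ N.coact = M.coact ≫ hom ▷ H.X
  quasilinear : hom ▷ H.X ≫ N.actAlpha = M.actAlpha ≫ hom

/-- The category of right-right `H`-Hopf modules. -/
instance : Category (HopfModule H) where
  Hom M N := Hom M N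
  id M := ⟨𝟙 M.X, by simp, by simp⟩
  comp f g := ⟨f.hom ≫ g.hom,
    by rw [Category.assoc, g.colinear, reassoc_of% f.colinear, comp_whiskerRight],
    by rw [comp_whiskerRight, Category.assoc, g.quasilinear, reassoc_of% f.quasilinear]⟩

/-- A Hopf module is strong if `φ_M ∘ ((φ_M ∘ (M ⊗ i_L)) ⊗ H) = φ_M ∘ (M ⊗ (μ_H ∘ (i_L ⊗ H)))`. -/
def IsStrong (H : WeakHopfQuasigroup C) : ObjectProperty (HopfModule H) := fun M =>
  (M.X ◁ H.iL ≫ M.act) ▷ H.X ≫ M.act = (α_ M.X H.HL H.X).hom ≫ M.X ◁ H.phiL ≫ M.act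

end HopfModule

variable [IsIdempotentComplete C]

/-- The category of strong Hopf modules, a full subcategory of the category of Hopf modules. -/
abbrev StrongHopfModule (H : WeakHopfQuasigroup C) := (HopfModule.IsStrong H).FullSubcategory

/-- A right `H_L`-module. -/
structure RightHLModule (H : WeakHopfQuasigroup C) where
  /-- the underlying object -/
  X : C
  /-- the action -/
  act : X ⊗ H.HL ⟶ X
  act_one : X ◁ H.oneL ≫ act = (ρ_ X).hom
  act_mul : X ◁ H.mulL ≫ act = (α_ X H.HL H.HL).inv ≫ act ▷ H.HL ≫ act

namespace RightHLModule

variable {H : WeakHopfQuasigroup C}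

/-- Morphisms of right `H_L`-modules. -/
@[ext]
structure Hom (N P : RightHLModule H) where
  /-- the underlying morphism -/
  hom : N.X ⟶ P.X
  linear : hom ▷ H.HL ≫ P.act = N.act ≫ hom

/-- The category of right `H_L`-modules. -/
instance : Category (RightHLModule H) where
  Hom N P := Hom N P
  id N := ⟨𝟙 N.X, by simp⟩
  comp f g := ⟨f.hom ≫ g.hom,
    by rw [comp_whiskerRight, Category.assoc, g.linear, reassoc_of% f.linear]⟩

end RightHLModule

/-- `F` is the induction functor `- ⊗_{H_L} H`: the underlying object of `F N` is a coequalizer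
`n N : N ⊗ H ⟶ N ⊗_{H_L} H` of `ψ_N ⊗ H` and `N ⊗ (μ_H ∘ (i_L ⊗ H))`, with the action and the
coaction induced by the product and the coproduct of `H`; and `F f` is induced by `f ⊗ H`. -/
structure IsInductionFunctor {H : WeakHopfQuasigroup C}
    (F : RightHLModule H ⥤ StrongHopfModule H) : Prop where
  exists_coequalizer : ∃ n : ∀ N : RightHLModule H, N.X ⊗ H.X ⟶ (F.obj N).obj.X,
    (∀ N : RightHLModule H,
      (∃ w : N.act ▷ H.X ≫ n N = ((α_ N.X H.HL H.X).hom ≫ N.X ◁ H.phiL) ≫ n N,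
        Nonempty (IsColimit (Cofork.ofπ (n N) w))) ∧
      n N ▷ H.X ≫ (F.obj N).obj.act = (α_ N.X H.X H.X).hom ≫ N.X ◁ H.mul ≫ n N ∧
      n N ≫ (F.obj N).obj.coact = N.X ◁ Δ[H.X] ≫ (α_ N.X H.X H.X).inv ≫ n N ▷ H.X) ∧
    ∀ (N P : RightHLModule H) (f : N ⟶ P),
      n N ≫ (F.map f).hom.hom = f.hom ▷ H.X ≫ n P

/-- `G` is the functor of coinvariants `(-)^{co H}`: the underlying object of `G M` is an image
`M ⟶ M^{co H} ⟶ M` of the idempotent `q_M`, with the action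
`p_M ∘ φ_M ∘ (i_M ⊗ i_L)`; and `G g` is the restriction of `g` to the coinvariants. -/
structure IsCoinvariantsFunctor {H : WeakHopfQuasigroup C}
    (G : StrongHopfModule H ⥤ RightHLModule H) : Prop where
  exists_image : ∃ (p : ∀ M : StrongHopfModule H, M.obj.X ⟶ (G.obj M).X)
      (i : ∀ M : StrongHopfModule H, (G.obj M).X ⟶ M.obj.X),
    (∀ M : StrongHopfModule H,
      p M ≫ i M = M.obj.q ∧ i M ≫ p M = 𝟙 (G.obj M).X ∧
      (G.obj M).act = (i M ⊗ₘ H.iL) ≫ M.obj.act ≫ p M) ∧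
    ∀ (M T : StrongHopfModule H) (g : M ⟶ T),
      (G.map g).hom ≫ i T = i M ≫ g.hom.hom

end

end

/-! Element notation is shorthand for string diagrams: δ(h) = h₁ ⊗ h₂, δ(1) = 1₁ ⊗ 1₂, ρ(m) = m₀ ⊗
m₁, and "z in H_L" means precomposition with Π^L or i_L. Call n in M coinvariant if ρ(n) lies in M ⊗
H_L. The coinvariants are exactly the image of q (`isCoinv_q`, `IsCoinv.comp_q`); they satisfy ρ(nh)
= n h₁ ⊗ h₂ and q(nh) = n Π^L(h) (`IsCoinv.act_coact`, `IsCoinv.act_q`); and every m equals q(m₀) m₁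
(`coact_q_act`). Hence the counit n ⊗ h ↦ nh has inverse m ↦ p(m₀) ⊗ m₁: one composite is q(m₀) m₁ =
m, the other is n ⊗ Π^L(h₁) h₂ = n ⊗ h (`d_L_m`). The unit n ↦ n ⊗ 1 is inverted by restricting n ⊗
h ↦ n p_L(h) to the coinvariants, because n p_L(h) ⊗ 1 = n ⊗ Π^L(h) = q(n ⊗ h).

Associativity is replaced by two cases: a product associates when its left or its middle factor lies
in H_L (`L_m_m'`, `L_m_m`). Both follow from xy = ε(x₁y₁) x₂y₂, since ε of a triple product does not
depend on the bracketing, together with control of δ on products with z in H_L, such as δ(zk) = z k₁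
⊗ k₂. The antipode enters most seriously through `d_s_g_L`, which makes q land in the coinvariants.

Morphisms of Hopf modules preserve only the transported action q(m₀)(m₁h). This action determines q
(`coact_s_actAlpha`) and agrees with φ_M on the coinvariants of a strong module
(`IsCoinv.actAlpha`), so morphisms restrict to H_L-linear maps on coinvariants.

Each diagram is a natural transformation in an object X of idle strands on the left, and `▷ H.X`
adds an idle strand on the right. The interchange law is then naturality, which `simp` applies by
moving operations on left strands to the end; coherence isomorphisms appear only when axioms are
translated. -/

namespace WeakHopfQuasigroup

variable {C : Type u} [Category.{v} C] [MonoidalCategory C] [BraidedCategory C]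

/-! ### The structure morphisms of `H` as natural transformations between powers of `- ⊗ H` -/

section

variable (H : WeakHopfQuasigroup C)

/-- The unit of `H`, as a natural transformation `𝟭 ⟶ - ⊗ H`. -/
def u (X : C) : X ⟶ X ⊗ H.X := (ρ_ X).inv ≫ X ◁ H.one

/-- The product of `H`, as a natural transformation `(- ⊗ H) ⊗ H ⟶ - ⊗ H`. -/
def m (X : C) : (X ⊗ H.X) ⊗ H.X ⟶ X ⊗ H.X := (α_ X H.X H.X).hom ≫ X ◁ H.mul

/-- The coproduct of `H`, as a natural transformation `- ⊗ H ⟶ (- ⊗ H) ⊗ H`. -/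
def d (X : C) : X ⊗ H.X ⟶ (X ⊗ H.X) ⊗ H.X := X ◁ Δ[H.X] ≫ (α_ X H.X H.X).inv

/-- The counit of `H`, as a natural transformation `- ⊗ H ⟶ 𝟭`. -/
def e (X : C) : X ⊗ H.X ⟶ X := X ◁ ε[H.X] ≫ (ρ_ X).hom

/-- The antipode of `H`, as a natural transformation of `- ⊗ H`. -/
def s (X : C) : X ⊗ H.X ⟶ X ⊗ H.X := X ◁ H.antipode

/-- The braiding of `H` with itself, as a natural transformation of `(- ⊗ H) ⊗ H`. -/
def b (X : C) : (X ⊗ H.X) ⊗ H.X ⟶ (X ⊗ H.X) ⊗ H.X :=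
  (α_ X H.X H.X).hom ≫ X ◁ (β_ H.X H.X).hom ≫ (α_ X H.X H.X).inv

/-- The inverse of the braiding of `H` with itself. -/
def bInv (X : C) : (X ⊗ H.X) ⊗ H.X ⟶ (X ⊗ H.X) ⊗ H.X :=
  (α_ X H.X H.X).hom ≫ X ◁ (β_ H.X H.X).inv ≫ (α_ X H.X H.X).inv

/-- The target morphism `Π^L`, as a natural transformation of `- ⊗ H`. -/
def L (X : C) : X ⊗ H.X ⟶ X ⊗ H.X := X ◁ H.PiL

/-- The source morphism `Π^R`, as a natural transformation of `- ⊗ H`. -/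
def P (X : C) : X ⊗ H.X ⟶ X ⊗ H.X := X ◁ H.PiR

end

/-! ### Naturality squares, as simp rules for the interchange law. -/

section

variable (H : WeakHopfQuasigroup C) {X Y : C} (f : X ⟶ Y)

@[simp]
theorem u_nat : f ≫ H.u Y = H.u X ≫ f ▷ H.X := by
  simp [u, whisker_exchange]

@[simp]
theorem m_nat : f ▷ H.X ▷ H.X ≫ H.m Y = H.m X ≫ f ▷ H.X := by
  simp [m, whisker_exchange]

@[simp]
theorem d_nat : f ▷ H.X ≫ H.d Y = H.d X ≫ f ▷ H.X ▷ H.X := by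
  simp [d, ← whisker_exchange_assoc]

@[simp]
theorem e_nat : f ▷ H.X ≫ H.e Y = H.e X ≫ f := by
  simp [e, ← whisker_exchange_assoc]

@[simp]
theorem s_nat : f ▷ H.X ≫ H.s Y = H.s X ≫ f ▷ H.X := by
  simp [s, whisker_exchange]

@[simp]
theorem L_nat : f ▷ H.X ≫ H.L Y = H.L X ≫ f ▷ H.X := by
  simp [L, whisker_exchange]

@[simp]
theorem P_nat : f ▷ H.X ≫ H.P Y = H.P X ≫ f ▷ H.X := by
  simp [P, whisker_exchange]

@[simp]
theorem b_nat : f ▷ H.X ▷ H.X ≫ H.b Y = H.b X ≫ f ▷ H.X ▷ H.X := by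
  simp only [b, Category.assoc, associator_naturality_left_assoc, ← whisker_exchange_assoc,
    associator_inv_naturality_left]

@[simp]
theorem u_nat_assoc {Z : C} (h : Y ⊗ H.X ⟶ Z) : f ≫ H.u Y ≫ h = H.u X ≫ f ▷ H.X ≫ h := by
  simp only [← Category.assoc, u_nat]

@[simp]
theorem m_nat_assoc {Z : C} (h : Y ⊗ H.X ⟶ Z) :
    f ▷ H.X ▷ H.X ≫ H.m Y ≫ h = H.m X ≫ f ▷ H.X ≫ h := by
  simp only [← Category.assoc, m_nat]

@[simp]
theorem d_nat_assoc {Z : C} (h : (Y ⊗ H.X) ⊗ H.X ⟶ Z) :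
    f ▷ H.X ≫ H.d Y ≫ h = H.d X ≫ f ▷ H.X ▷ H.X ≫ h := by
  simp only [← Category.assoc, d_nat]

@[simp]
theorem s_nat_assoc {Z : C} (h : Y ⊗ H.X ⟶ Z) : f ▷ H.X ≫ H.s Y ≫ h = H.s X ≫ f ▷ H.X ≫ h := by
  simp only [← Category.assoc, s_nat]

@[simp]
theorem L_nat_assoc {Z : C} (h : Y ⊗ H.X ⟶ Z) : f ▷ H.X ≫ H.L Y ≫ h = H.L X ≫ f ▷ H.X ≫ h := by
  simp only [← Category.assoc, L_nat]

@[simp]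
theorem P_nat_assoc {Z : C} (h : Y ⊗ H.X ⟶ Z) : f ▷ H.X ≫ H.P Y ≫ h = H.P X ≫ f ▷ H.X ≫ h := by
  simp only [← Category.assoc, P_nat]

@[simp]
theorem b_nat_assoc {Z : C} (h : (Y ⊗ H.X) ⊗ H.X ⟶ Z) :
    f ▷ H.X ▷ H.X ≫ H.b Y ≫ h = H.b X ≫ f ▷ H.X ▷ H.X ≫ h := by
  simp only [← Category.assoc, b_nat]

end

/-! ### The axioms of H and of the braiding, as identities of natural transformations. -/

section

variable (H : WeakHopfQuasigroup C) (X : C)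

theorem bInv_b : H.bInv X ≫ H.b X = 𝟙 _ := by simp [bInv, b]

theorem b_bInv : H.b X ≫ H.bInv X = 𝟙 _ := by simp [bInv, b]

theorem u_m : H.u X ▷ H.X ≫ H.m X = 𝟙 _ := by
  have := congrArg (X ◁ ·) H.one_mul
  simp at this
  simp [u, m, this]

theorem u_m' : H.u (X ⊗ H.X) ≫ H.m X = 𝟙 _ := by
  have := congrArg (X ◁ ·) H.mul_one
  simp at this
  simp [u, m, this]

theorem d_d : H.d X ≫ H.d X ▷ H.X = H.d X ≫ H.d (X ⊗ H.X) := by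
  have := congrArg (fun t => X ◁ t ≫ (α_ X H.X (H.X ⊗ H.X)).inv ≫ (α_ (X ⊗ H.X) H.X H.X).inv)
    (ComonObj.comul_assoc H.X)
  refine Eq.trans ?_ (this.symm.trans ?_)
  · simp only [d]
    monoidal
  · simp only [d]
    monoidal

theorem d_e' : H.d X ≫ H.e X ▷ H.X = 𝟙 _ := by
  have := congrArg (fun t => X ◁ t ≫ X ◁ (λ_ _).hom) (ComonObj.counit_comul H.X)
  refine Eq.trans ?_ (this.trans ?_)
  · simp only [d, e]
    monoidal
  · monoidal

theorem d_e : H.d X ≫ H.e (X ⊗ H.X) = 𝟙 _ := by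
  have := congrArg (fun t => X ◁ t ≫ X ◁ (ρ_ _).hom) (ComonObj.comul_counit H.X)
  refine Eq.trans ?_ (this.trans ?_)
  · simp only [d, e]
    monoidal
  · monoidal

/-- The natural transformation `h ⊗ k ↦ k₁ ⊗ h k₂`. -/
def g : (X ⊗ H.X) ⊗ H.X ⟶ (X ⊗ H.X) ⊗ H.X :=
  H.d (X ⊗ H.X) ≫ H.b X ▷ H.X ≫ H.m (X ⊗ H.X)

@[simp]
theorem g_nat {X Y : C} (f : X ⟶ Y) : f ▷ H.X ▷ H.X ≫ H.g Y = H.g X ≫ f ▷ H.X ▷ H.X := by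
  simp only [g, Category.assoc, d_nat_assoc, ← comp_whiskerRight_assoc, b_nat]
  simp

@[simp]
theorem g_nat_assoc {X Y Z : C} (f : X ⟶ Y) (h : (Y ⊗ H.X) ⊗ H.X ⟶ Z) :
    f ▷ H.X ▷ H.X ≫ H.g Y ≫ h = H.g X ≫ f ▷ H.X ▷ H.X ≫ h := by
  simp only [← Category.assoc, g_nat]

end

section

variable (H : WeakHopfQuasigroup C)

@[simp]
theorem whisker_e_nat {X Y : C} (f : X ⟶ Y) :
    f ▷ H.X ▷ H.X ≫ H.e Y ▷ H.X = H.e X ▷ H.X ≫ f ▷ H.X := by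
  simp only [← comp_whiskerRight, e_nat]

-- These are the naturality squares under one more idle strand. They are needed separately because
-- `simp` splits whiskered composites, after which the unwhiskered rules no longer match.
@[simp]
theorem whisker_nat_assoc {X Y : C} (f : X ⟶ Y) :
    (∀ {Z : C} (h : (Y ⊗ H.X) ⊗ H.X ⟶ Z),
      f ▷ H.X ≫ H.u Y ▷ H.X ≫ h = H.u X ▷ H.X ≫ f ▷ H.X ▷ H.X ≫ h) ∧
    (∀ {Z : C} (h : (Y ⊗ H.X) ⊗ H.X ⟶ Z),
      f ▷ H.X ▷ H.X ▷ H.X ≫ H.m Y ▷ H.X ≫ h = H.m X ▷ H.X ≫ f ▷ H.X ▷ H.X ≫ h) ∧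
    (∀ {Z : C} (h : ((Y ⊗ H.X) ⊗ H.X) ⊗ H.X ⟶ Z),
      f ▷ H.X ▷ H.X ≫ H.d Y ▷ H.X ≫ h = H.d X ▷ H.X ≫ f ▷ H.X ▷ H.X ▷ H.X ≫ h) ∧
    (∀ {Z : C} (h : (Y ⊗ H.X) ⊗ H.X ⟶ Z),
      f ▷ H.X ▷ H.X ≫ H.s Y ▷ H.X ≫ h = H.s X ▷ H.X ≫ f ▷ H.X ▷ H.X ≫ h) ∧
    (∀ {Z : C} (h : (Y ⊗ H.X) ⊗ H.X ⟶ Z),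
      f ▷ H.X ▷ H.X ≫ H.L Y ▷ H.X ≫ h = H.L X ▷ H.X ≫ f ▷ H.X ▷ H.X ≫ h) ∧
    (∀ {Z : C} (h : ((Y ⊗ H.X) ⊗ H.X) ⊗ H.X ⟶ Z),
      f ▷ H.X ▷ H.X ▷ H.X ≫ H.b Y ▷ H.X ≫ h = H.b X ▷ H.X ≫ f ▷ H.X ▷ H.X ▷ H.X ≫ h) := by
  simp only [← comp_whiskerRight_assoc, u_nat, m_nat, d_nat, s_nat, L_nat, b_nat, implies_true,
    and_self]

end

section

variable (H : WeakHopfQuasigroup C) (X : C)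

theorem m_d : H.m X ≫ H.d X = H.d X ▷ H.X ≫ H.g (X ⊗ H.X) ≫ H.m X ▷ H.X := by
  have := congrArg (fun t => (α_ X H.X H.X).hom ≫ X ◁ t ≫ (α_ X H.X H.X).inv) H.mul_comul
  refine Eq.trans ?_ (this.trans ?_)
  · simp [m, d]
  · simp only [m, d, g, b, tensorμ,
      MonoidalCategory.tensorHom_def Δ[H.X] Δ[H.X], MonoidalCategory.tensorHom_def' H.mul H.mul]
    monoidal

theorem m_m_e : H.m X ▷ H.X ≫ H.m X ≫ H.e X = H.m (X ⊗ H.X) ≫ H.m X ≫ H.e X := by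
  have := congrArg (X ◁ ·) H.counit_mul_assoc
  simp at this
  simp [m, e, reassoc_of% this]

theorem m_m_e_braid : H.m X ▷ H.X ≫ H.m X ≫ H.e X =
    H.d (X ⊗ H.X) ▷ H.X ≫ H.bInv _ ▷ H.X ≫ H.m _ ≫ H.e _ ≫ H.m X ≫ H.e X := by
  have := congrArg (fun t => (α_ X H.X H.X).hom ▷ H.X ≫ (α_ X (H.X ⊗ H.X) H.X).hom ≫ X ◁ t ≫
    (ρ_ X).hom) H.counit_mul_mul_braiding
  refine Eq.trans ?_ (this.trans ?_)
  · simp [m, e]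
  · simp only [m, d, e, bInv, MonoidalCategory.tensorHom_def']
    monoidal

theorem u_d_d : H.u X ≫ H.d X ≫ H.d X ▷ H.X =
    H.u X ≫ H.d X ≫ H.u _ ≫ H.d _ ≫ H.m _ ▷ H.X := by
  have := congrArg (fun t => (ρ_ X).inv ≫ X ◁ t ≫ (α_ X (H.X ⊗ H.X) H.X).inv ≫
    (α_ X H.X H.X).inv ▷ H.X) H.one_comul_comul
  refine Eq.trans ?_ (this.trans ?_)
  · simp [u, d]
  · simp only [m, d, u, MonoidalCategory.tensorHom_def]
    monoidal

theorem u_d_d_braid : H.u X ≫ H.d X ≫ H.d X ▷ H.X =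
    H.u X ≫ H.d X ≫ H.u _ ≫ H.d _ ≫ H.bInv _ ▷ H.X ≫ H.m _ ▷ H.X := by
  have := congrArg (fun t => (ρ_ X).inv ≫ X ◁ t ≫ (α_ X (H.X ⊗ H.X) H.X).inv ≫
    (α_ X H.X H.X).inv ▷ H.X) H.one_comul_comul_braiding
  refine Eq.trans ?_ (this.trans ?_)
  · simp [u, d]
  · simp only [m, d, u, bInv, MonoidalCategory.tensorHom_def]
    monoidal

theorem L_eq : H.L X = H.d X ≫ H.s _ ≫ H.m X := by
  simp [L, d, s, m, PiL, convolutionProduct]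

theorem L_eq_unit : H.L X = H.u X ▷ H.X ≫ H.d X ▷ H.X ≫ H.b _ ≫ H.m X ▷ H.X ≫ H.e X ▷ H.X := by
  refine (congrArg (X ◁ ·) H.target_eq).trans ?_
  simp only [m, d, u, b, e]
  monoidal

theorem P_eq_unit : H.P X = H.u _ ≫ H.g X ≫ H.e _ := by
  refine (congrArg (X ◁ ·) H.source_eq).trans ?_
  simp only [m, d, u, b, e, g]
  monoidal

theorem s_m_m : H.d X ▷ H.X ≫ H.s X ▷ H.X ▷ H.X ≫ H.m _ ≫ H.m X = H.P X ▷ H.X ≫ H.m X := by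
  refine Eq.trans ?_ ((congrArg ((α_ X H.X H.X).hom ≫ X ◁ ·) H.antipode_mul_mul).trans ?_)
  · simp only [m, d, s, MonoidalCategory.tensorHom_def]
    monoidal
  · simp [P, PiR, m]

theorem m_s_m : H.d _ ≫ H.m X ▷ H.X ≫ H.s _ ≫ H.m X = H.L _ ≫ H.m X := by
  refine Eq.trans ?_ ((congrArg ((α_ X H.X H.X).hom ≫ X ◁ ·) H.mul_mul_antipode).trans ?_)
  · simp only [m, d, s, MonoidalCategory.tensorHom_def]
    monoidal
  · simp [L, PiL, m]

theorem s_m_m' : H.d _ ≫ H.s _ ▷ H.X ≫ H.m X ▷ H.X ≫ H.m X = H.P _ ≫ H.m X := by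
  refine Eq.trans ?_ ((congrArg ((α_ X H.X H.X).hom ≫ X ◁ ·) H.mul_antipode_mul').trans ?_)
  · simp only [m, d, s]
    monoidal
  · simp [P, PiR, m]

/-! Compatibility of the braiding with the structure morphisms. -/

theorem u_b : H.u (X ⊗ H.X) ≫ H.b X = H.u X ▷ H.X := by
  have := congrArg (fun t => X ◁ ((ρ_ H.X).inv ≫ t) ≫ (α_ X H.X H.X).inv)
    (BraidedCategory.braiding_naturality_right H.X H.one)
  refine Eq.trans ?_ (this.trans ?_)
  · simp only [u, b]
    monoidal
  · simp [u]

theorem u_b' : H.u X ▷ H.X ≫ H.b X = H.u (X ⊗ H.X) := by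
  have := congrArg (fun t => X ◁ ((λ_ H.X).inv ≫ t) ≫ (α_ X H.X H.X).inv)
    (BraidedCategory.braiding_naturality_left H.one H.X)
  refine Eq.trans ?_ (this.trans ?_)
  · simp only [u, b]
    monoidal
  · simp [u]

theorem b_e : H.b X ≫ H.e _ = H.e X ▷ H.X := by
  have := congrArg (fun t => (α_ X H.X H.X).hom ≫ X ◁ (t ≫ (ρ_ H.X).hom))
    (BraidedCategory.braiding_naturality_left ε[H.X] H.X)
  refine Eq.trans ?_ (this.symm.trans ?_)
  · simp only [e, b]
    monoidal
  · simp [e]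

theorem b_e' : H.b X ≫ H.e X ▷ H.X = H.e _  := by
  have := congrArg (fun t => (α_ X H.X H.X).hom ≫ X ◁ (t ≫ (λ_ H.X).hom))
    (BraidedCategory.braiding_naturality_right H.X ε[H.X])
  refine Eq.trans ?_ (this.symm.trans ?_)
  · simp only [e, b]
    monoidal
  · simp [e]

theorem b_d : H.b X ≫ H.d (X ⊗ H.X) = H.d X ▷ H.X ≫ H.b (X ⊗ H.X) ≫ H.b X ▷ H.X := by
  have := congrArg (fun t => (α_ X H.X H.X).hom ≫ X ◁ t ≫ (α_ X H.X (H.X ⊗ H.X)).inv ≫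
    (α_ (X ⊗ H.X) H.X H.X).inv) (BraidedCategory.braiding_naturality_left Δ[H.X] H.X)
  refine Eq.trans ?_ (this.symm.trans ?_)
  · simp only [d, b]
    monoidal
  · simp only [d, b, BraidedCategory.braiding_tensor_left_hom]
    monoidal

theorem b_d' : H.b X ≫ H.d X ▷ H.X = H.d (X ⊗ H.X) ≫ H.b X ▷ H.X ≫ H.b (X ⊗ H.X) := by
  have := congrArg (fun t => (α_ X H.X H.X).hom ≫ X ◁ t ≫ (α_ X (H.X ⊗ H.X) H.X).inv ≫
    (α_ X H.X H.X).inv ▷ H.X) (BraidedCategory.braiding_naturality_right H.X Δ[H.X])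
  refine Eq.trans ?_ (this.symm.trans ?_)
  · simp only [d, b]
    monoidal
  · simp only [d, b, BraidedCategory.braiding_tensor_right_hom]
    monoidal

theorem m_b : H.m (X ⊗ H.X) ≫ H.b X = H.b X ▷ H.X ≫ H.b (X ⊗ H.X) ≫ H.m X ▷ H.X := by
  have := congrArg (fun t => (α_ (X ⊗ H.X) H.X H.X).hom ≫ (α_ X H.X (H.X ⊗ H.X)).hom ≫
    X ◁ t ≫ (α_ X H.X H.X).inv) (BraidedCategory.braiding_naturality_right H.X H.mul)
  refine Eq.trans ?_ (this.trans ?_)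
  · simp only [m, b]
    monoidal
  · simp only [m, b, BraidedCategory.braiding_tensor_right_hom]
    monoidal

theorem m_b' : H.m X ▷ H.X ≫ H.b X = H.b (X ⊗ H.X) ≫ H.b X ▷ H.X ≫ H.m (X ⊗ H.X) := by
  have := congrArg (fun t => (α_ X H.X H.X).hom ▷ H.X ≫ (α_ X (H.X ⊗ H.X) H.X).hom ≫
    X ◁ t ≫ (α_ X H.X H.X).inv) (BraidedCategory.braiding_naturality_left H.mul H.X)
  refine Eq.trans ?_ (this.trans ?_)
  · simp only [m, b]
    monoidal
  · simp only [m, b, BraidedCategory.braiding_tensor_left_hom]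
    monoidal

theorem b_L : H.b X ≫ H.L _ = H.L X ▷ H.X ≫ H.b X := by
  have := congrArg (fun t => (α_ X H.X H.X).hom ≫ X ◁ t ≫ (α_ X H.X H.X).inv)
    (BraidedCategory.braiding_naturality_left H.PiL H.X)
  refine Eq.trans ?_ (this.symm.trans ?_)
  · simp only [L, b]
    monoidal
  · simp only [L, b]
    monoidal

theorem b_L' : H.b X ≫ H.L X ▷ H.X = H.L _ ≫ H.b X := by
  have := congrArg (fun t => (α_ X H.X H.X).hom ≫ X ◁ t ≫ (α_ X H.X H.X).inv)
    (BraidedCategory.braiding_naturality_right H.X H.PiL)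
  refine Eq.trans ?_ (this.symm.trans ?_)
  · simp only [L, b]
    monoidal
  · simp only [L, b]
    monoidal

end

end WeakHopfQuasigroup

/-! ### The Hopf module axioms in the same language. -/

namespace HopfModule

variable {C : Type u} [Category.{v} C] [MonoidalCategory C] [BraidedCategory C]
  {H : WeakHopfQuasigroup C} (M : HopfModule H)

theorem coact_e : M.coact ≫ H.e _ = 𝟙 _ := by
  simp [WeakHopfQuasigroup.e, reassoc_of% M.coact_counit]

theorem coact_d : M.coact ≫ H.d _ = M.coact ≫ M.coact ▷ H.X := M.coact_coact.symm

theorem u_act : H.u _ ≫ M.act = 𝟙 _ := by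
  simp [WeakHopfQuasigroup.u, M.act_one]

theorem act_comp_coact : M.act ≫ M.coact = M.coact ▷ H.X ≫ H.g _ ≫ M.act ▷ H.X := by
  refine M.act_coact.trans ?_
  simp only [WeakHopfQuasigroup.m, WeakHopfQuasigroup.d, WeakHopfQuasigroup.b,
    WeakHopfQuasigroup.g, tensorμ, MonoidalCategory.tensorHom_def M.coact,
    MonoidalCategory.tensorHom_def' M.act]
  monoidal

theorem act_s_act : H.d _ ≫ M.act ▷ H.X ≫ H.s _ ≫ M.act = H.L _ ≫ M.act := by
  refine Eq.trans ?_ M.act_act_antipode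
  simp only [WeakHopfQuasigroup.d, WeakHopfQuasigroup.s, MonoidalCategory.tensorHom_def]
  monoidal

theorem s_act_act : H.d _ ≫ H.s _ ▷ H.X ≫ M.act ▷ H.X ≫ M.act = H.P _ ≫ M.act := by
  refine Eq.trans ?_ M.act_antipode_act
  simp only [WeakHopfQuasigroup.d, WeakHopfQuasigroup.s]
  monoidal

end HopfModule

/-! ### The target morphism, its image, and products with it on the right. -/

namespace WeakHopfQuasigroup

variable {C : Type u} [Category.{v} C] [MonoidalCategory C] [BraidedCategory C]
variable (H : WeakHopfQuasigroup C) (X : C)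

/-! ### Identities in a weak Hopf quasigroup -/

theorem yang_baxter : H.b X ▷ H.X ≫ H.b (X ⊗ H.X) ≫ H.b X ▷ H.X =
    H.b (X ⊗ H.X) ≫ H.b X ▷ H.X ≫ H.b (X ⊗ H.X) := by
  have := congrArg (fun t => (α_ _ _ _).hom ≫ (α_ X H.X (H.X ⊗ H.X)).hom ≫ X ◁ t ≫
    (α_ _ _ _).inv ≫ (α_ _ _ _).inv) (BraidedCategory.yang_baxter H.X H.X H.X)
  refine Eq.trans ?_ (this.trans ?_)
  · simp only [b]
    monoidal
  · simp only [b]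
    monoidal

theorem b_b_bInv : H.b X ▷ H.X ≫ H.b (X ⊗ H.X) ≫ H.bInv X ▷ H.X =
    H.bInv (X ⊗ H.X) ≫ H.b X ▷ H.X ≫ H.b (X ⊗ H.X) := by
  calc _ = H.bInv (X ⊗ H.X) ≫ (H.b (X ⊗ H.X) ≫ H.b X ▷ H.X ≫ H.b (X ⊗ H.X)) ≫
        H.bInv X ▷ H.X := by simp [reassoc_of% H.bInv_b]
    _ = _ := by
      rw [← yang_baxter]
      simp [← comp_whiskerRight, b_bInv]

/-- The natural transformation `h ⊗ k ↦ ε(h k)`. -/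
def me : (X ⊗ H.X) ⊗ H.X ⟶ X := H.m X ≫ H.e X

variable {X} in
@[simp]
theorem me_nat {Y : C} (f : X ⟶ Y) : f ▷ H.X ▷ H.X ≫ H.me Y = H.me X ≫ f := by simp [me]

/-- The element `δ(1)`, as a natural transformation. -/
def ud : X ⟶ (X ⊗ H.X) ⊗ H.X := H.u X ≫ H.d X

variable {X} in
@[simp]
theorem ud_nat {Y : C} (f : X ⟶ Y) : f ≫ H.ud Y = H.ud X ≫ f ▷ H.X ▷ H.X := by simp [ud]

variable {X} in
@[simp]
theorem ud_nat_assoc {Y Z : C} (f : X ⟶ Y) (h : (Y ⊗ H.X) ⊗ H.X ⟶ Z) :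
    f ≫ H.ud Y ≫ h = H.ud X ≫ f ▷ H.X ▷ H.X ≫ h := by simp [ud]

/-- The morphism `h ↦ ε(h 1₁) 1₂`. -/
def R : X ⊗ H.X ⟶ X ⊗ H.X := H.ud _ ≫ H.me X ▷ H.X

variable {X} in
@[simp]
theorem R_nat {Y : C} (f : X ⟶ Y) : f ▷ H.X ≫ H.R Y = H.R X ≫ f ▷ H.X := by simp [R, me]

variable {X} in
@[simp]
theorem whisker_nat' {Y : C} (f : X ⟶ Y) :
    f ▷ H.X ≫ H.ud Y ▷ H.X = H.ud X ▷ H.X ≫ f ▷ H.X ▷ H.X ▷ H.X ∧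
    f ▷ H.X ▷ H.X ▷ H.X ≫ H.me Y ▷ H.X = H.me X ▷ H.X ≫ f ▷ H.X ∧
    f ▷ H.X ▷ H.X ≫ H.R Y ▷ H.X = H.R X ▷ H.X ≫ f ▷ H.X ▷ H.X := by
  simp only [← comp_whiskerRight, ud_nat, me_nat, R_nat, and_self]

variable {X} in
@[simp]
theorem whisker_ud_nat_assoc {Y Z : C} (f : X ⟶ Y) (h : ((Y ⊗ H.X) ⊗ H.X) ⊗ H.X ⟶ Z) :
    f ▷ H.X ≫ H.ud Y ▷ H.X ≫ h = H.ud X ▷ H.X ≫ f ▷ H.X ▷ H.X ▷ H.X ≫ h := by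
  simp only [← comp_whiskerRight_assoc, ud_nat]

variable {X} in
@[simp]
theorem whisker_me_nat_assoc {Y Z : C} (f : X ⟶ Y) (h : (Y ⊗ H.X) ⊗ H.X ⟶ Z) :
    f ▷ H.X ▷ H.X ▷ H.X ▷ H.X ≫ H.me Y ▷ H.X ▷ H.X ≫ h =
      H.me X ▷ H.X ▷ H.X ≫ f ▷ H.X ▷ H.X ≫ h := by
  simp only [← comp_whiskerRight_assoc, whisker_nat']

theorem m_me : H.m X ▷ H.X ≫ H.me X = H.m (X ⊗ H.X) ≫ H.me X := H.m_m_e X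

theorem m_me_braid :
    H.m X ▷ H.X ≫ H.me X = H.d (X ⊗ H.X) ▷ H.X ≫ H.bInv _ ▷ H.X ≫ H.me _ ≫ H.me X := by
  simpa [me] using H.m_m_e_braid X

theorem ud_d : H.ud X ≫ H.d _ = H.ud X ≫ H.d _ ▷ H.X := by
  simp only [ud, Category.assoc, d_d]

theorem ud_d' : H.ud X ≫ H.d X ▷ H.X = H.ud X ≫ H.ud _ ≫ H.m _ ▷ H.X := by
  simpa [ud] using H.u_d_d X

theorem ud_d_braid : H.ud X ≫ H.d X ▷ H.X = H.ud X ≫ H.ud _ ≫ H.bInv _ ▷ H.X ≫ H.m _ ▷ H.X := by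
  simpa [ud] using H.u_d_d_braid X

theorem L_eq_ud : H.L X = H.ud X ▷ H.X ≫ H.b _ ≫ H.me X ▷ H.X := by
  simp [ud, me, L_eq_unit]

theorem b_b_me : H.b X ▷ H.X ≫ H.b (X ⊗ H.X) ≫ H.me X ▷ H.X = H.me (X ⊗ H.X) := by
  simp only [me, comp_whiskerRight]
  rw [← reassoc_of% H.m_b, b_e']

theorem bInv_me : H.bInv X ▷ H.X ≫ H.me (X ⊗ H.X) = H.b (X ⊗ H.X) ≫ H.me X ▷ H.X := by
  rw [← b_b_me, ← comp_whiskerRight_assoc, bInv_b, id_whiskerRight, Category.id_comp]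

theorem bInv_me' : H.bInv (X ⊗ H.X) ≫ H.me X ▷ H.X = H.b X ▷ H.X ≫ H.me _ := by
  have : H.b (X ⊗ H.X) ≫ H.b X ▷ H.X ≫ H.me _ = H.me X ▷ H.X := by
    simp only [me, comp_whiskerRight]
    rw [← reassoc_of% H.m_b', b_e]
  rw [← this, reassoc_of% H.bInv_b]

theorem ud_b : H.ud X ▷ H.X ≫ H.b (X ⊗ H.X) = H.ud (X ⊗ H.X) ≫ H.bInv X ▷ H.X := by
  have : H.ud X ▷ H.X ≫ H.b (X ⊗ H.X) ≫ H.b X ▷ H.X = H.ud (X ⊗ H.X) := by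
    rw [ud, ud, comp_whiskerRight, Category.assoc, ← b_d, reassoc_of% H.u_b']
  rw [← this]
  simp [← comp_whiskerRight, b_bInv]

/-- The coproduct of the unit takes values in `H ⊗ H_L`. -/
theorem ud_L : H.ud X ≫ H.L _ = H.ud X := by
  calc H.ud X ≫ H.L _ = H.ud X ≫ (H.ud _ ▷ H.X ≫ H.b _) ≫ H.me _ ▷ H.X := by
        rw [L_eq_ud]; simp only [Category.assoc]
    _ = (H.ud X ≫ H.ud _ ≫ H.bInv _ ▷ H.X ≫ H.m _ ▷ H.X) ≫ H.e _ ▷ H.X := by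
        rw [ud_b]; simp only [me, comp_whiskerRight, Category.assoc]
    _ = H.ud X := by
        rw [← ud_d_braid, Category.assoc, ← comp_whiskerRight, d_e, id_whiskerRight,
          Category.comp_id]

/-- Applying ε to the middle factor of 1₁ ⊗ 1₂ ⊗ 1₃ = 1₁ ⊗ 1₂1'₁ ⊗ 1'₂ gives this; `ud_L` is the
same argument with the inverse braiding. -/
theorem ud_R : H.ud X ≫ H.R _ = H.ud X := by
  calc H.ud X ≫ H.R _ = (H.ud X ≫ H.ud _ ≫ H.m _ ▷ H.X) ≫ H.e _ ▷ H.X := by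
        simp only [R, me, comp_whiskerRight, Category.assoc]
    _ = H.ud X := by
        rw [← ud_d', Category.assoc, ← comp_whiskerRight, d_e, id_whiskerRight,
          Category.comp_id]

theorem b_R : H.b X ≫ H.R _ = H.R X ▷ H.X ≫ H.b X := by
  calc H.b X ≫ H.R _ = H.ud _ ≫ H.b X ▷ H.X ▷ H.X ≫ H.me _ ▷ H.X := by simp [R]
    _ = (H.ud _ ≫ H.bInv _ ▷ H.X) ≫ H.me X ▷ H.X ▷ H.X := by
        rw [Category.assoc, ← comp_whiskerRight, ← comp_whiskerRight, bInv_me']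
    _ = _ := by rw [← ud_b]; simp [R]

/-- The output of `R` is a second leg of δ(1), which Π^L fixes. Together with `L_R` this shows that
`R` and Π^L have the same image, so either formula may be used to express membership in H_L. -/
theorem R_L : H.R X ≫ H.L X = H.R X := by
  rw [R, Category.assoc, L_nat, reassoc_of% H.ud_L]

/-- By coassociativity, comultiplying the second leg of δ(1) leaves a last leg that is still a last
leg of δ(1). Hence δ maps H_L into H ⊗ H_L. -/
theorem R_d_L : H.R X ≫ H.d X ≫ H.L _ = H.R X ≫ H.d X := by
  calc H.R X ≫ H.d X ≫ H.L _ = (H.ud _ ≫ H.d _) ≫ H.L _ ≫ H.me X ▷ H.X ▷ H.X := by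
        simp [R]
    _ = (H.ud _ ≫ H.L _) ≫ H.d _ ▷ H.X ≫ H.me X ▷ H.X ▷ H.X := by
        rw [ud_d]; simp
    _ = _ := by
        rw [ud_L, ← reassoc_of% H.ud_d]; simp [R]

theorem L_R : H.L X ≫ H.R X = H.L X := by
  rw [L_eq_ud]
  simp only [Category.assoc, R_nat]
  rw [reassoc_of% H.b_R, ← comp_whiskerRight_assoc, ud_R]

theorem L_L : H.L X ≫ H.L X = H.L X := by
  rw [← reassoc_of% H.L_R X, R_L, L_R]

theorem L_d_L : H.L X ≫ H.d X ≫ H.L _ = H.L X ≫ H.d X := by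
  rw [← reassoc_of% H.L_R X, R_d_L, reassoc_of% H.L_R X]

theorem u_L : H.u X ≫ H.L X = H.u X := by
  calc H.u X ≫ H.L X = H.ud X ≫ (H.u _ ≫ H.b _) ≫ H.me X ▷ H.X := by
        rw [L_eq_ud, ← u_nat_assoc, Category.assoc]
    _ = H.ud X ≫ (H.u _ ≫ H.m X) ▷ H.X ≫ H.e X ▷ H.X := by
        rw [u_b]; simp only [me, comp_whiskerRight, Category.assoc]
    _ = H.u X := by simp [u_m', ud, d_e']

/-- `h Π^L(k) = ε(h₁ k) h₂`. -/
theorem L_m : H.L _ ≫ H.m X = H.d X ▷ H.X ≫ H.b _ ≫ H.me X ▷ H.X := by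
  -- A rearrangement by the braid relations, coassociativity at the unit and naturality of the
  -- braiding. It puts the scalars ε(h₁1₂) ε(1₁k) into the form of the counit axiom with the inverse
  -- braiding.
  have key (Y : C) : H.ud _ ▷ H.X ≫ H.b Y ▷ H.X ▷ H.X ≫ H.b _ ≫ H.b _ ▷ H.X ≫
      H.d Y ▷ H.X ▷ H.X ▷ H.X ≫ H.bInv Y ▷ H.X ▷ H.X ▷ H.X ≫ H.me _ ▷ H.X ▷ H.X =
      H.ud _ ▷ H.X ≫ H.b _ ≫ H.me _ ▷ H.X ≫ H.d (Y ⊗ H.X) ≫ H.b Y ▷ H.X := by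
    calc _ = H.ud _ ▷ H.X ≫ (H.b Y ≫ H.d Y ▷ H.X) ▷ H.X ▷ H.X ≫
          H.b _ ≫ H.b _ ▷ H.X ≫ H.bInv Y ▷ H.X ▷ H.X ▷ H.X ≫ H.me _ ▷ H.X ▷ H.X := by
          simp
      _ = H.ud _ ▷ H.X ≫ H.d (Y ⊗ H.X) ▷ H.X ▷ H.X ≫
          (H.b Y ▷ H.X ≫ H.b (Y ⊗ H.X) ≫ H.bInv Y ▷ H.X) ▷ H.X ▷ H.X ≫
          H.b _ ≫ H.b _ ▷ H.X ≫ H.me _ ▷ H.X ▷ H.X := by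
          rw [b_d']
          simp
      _ = H.ud _ ▷ H.X ≫ H.d (Y ⊗ H.X) ▷ H.X ▷ H.X ≫
          H.bInv (Y ⊗ H.X) ▷ H.X ▷ H.X ≫ H.b Y ▷ H.X ▷ H.X ▷ H.X ≫ H.b _ ≫
          (H.b (Y ⊗ H.X) ▷ H.X ≫ H.b _ ≫ H.me _ ▷ H.X) ▷ H.X := by
          rw [b_b_bInv]
          simp
      _ = H.ud _ ▷ H.X ≫ H.d (Y ⊗ H.X) ▷ H.X ▷ H.X ≫ H.b _ ≫
          (H.bInv (Y ⊗ H.X) ▷ H.X ≫ H.me _) ▷ H.X ≫ H.b Y ▷ H.X := by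
          rw [b_b_me]
          simp
      _ = (H.ud _ ≫ H.d _ ▷ H.X) ▷ H.X ≫ H.b _ ≫
          (H.b _ ≫ H.me _ ▷ H.X) ▷ H.X ≫ H.b Y ▷ H.X := by
          rw [bInv_me]
          simp
      _ = H.ud _ ▷ H.X ≫ (H.b _ ≫ H.d _) ≫ H.me _ ▷ H.X ▷ H.X ≫ H.b Y ▷ H.X := by
          rw [← ud_d, b_d]
          simp
      _ = _ := by simp
  -- Expanding by (ε ⊗ H)δ gives ε(1₁k) ε(h₁1₂) h₂1₃. The counit axiom merges the scalars into
  -- ε((h1₁)k), leaving h₂1₂ behind, and δ(h1) = δ(h) removes the unit.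
  calc H.L _ ≫ H.m X = H.L _ ≫ H.m X ≫ H.d X ≫ H.e X ▷ H.X := by
        rw [d_e', Category.comp_id]
    _ = H.L _ ≫ H.d X ▷ H.X ≫ H.d _ ≫ H.b _ ▷ H.X ≫ H.m _ ≫ H.me X ▷ H.X := by
        rw [reassoc_of% H.m_d]
        simp [g, me]
    _ = H.d X ▷ H.X ≫ (H.ud _ ▷ H.X ≫ H.b _ ≫ H.me _ ▷ H.X ≫ H.d _ ≫ H.b _ ▷ H.X) ≫ H.m _ ≫
        H.me X ▷ H.X := by
        simp [L_eq_ud]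
    _ = H.d X ▷ H.X ≫ (H.ud _ ▷ H.X ≫ H.b _ ▷ H.X ▷ H.X ≫ H.b _ ≫ H.b _ ▷ H.X ≫
        H.d _ ▷ H.X ▷ H.X ▷ H.X ≫ H.bInv _ ▷ H.X ▷ H.X ▷ H.X ≫ H.me _ ▷ H.X ▷ H.X) ≫ H.m _ ≫
        H.me X ▷ H.X := by rw [key]
    _ = (H.d X ▷ H.X ≫ H.ud _ ▷ H.X) ≫ H.b _ ▷ H.X ▷ H.X ≫ H.b _ ≫ H.b _ ▷ H.X ≫ H.m _ ≫
        (H.d _ ▷ H.X ≫ H.bInv _ ▷ H.X ≫ H.me _ ≫ H.me X) ▷ H.X := by simp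
    _ = (H.u _ ≫ H.d X ▷ H.X ≫ H.d _ ≫ H.b _ ▷ H.X) ▷ H.X ≫ H.b _ ≫ H.b _ ▷ H.X ≫ H.m _ ≫
        H.m _ ▷ H.X ▷ H.X ≫ H.me _ ▷ H.X := by
        rw [← m_me_braid]
        simp [ud]
    _ = (H.u _ ≫ H.d X ▷ H.X ≫ H.d _ ≫ H.b _ ▷ H.X) ▷ H.X ≫ (H.b _ ≫ H.b _ ▷ H.X ≫ H.m _) ≫
        H.m _ ▷ H.X ▷ H.X ≫ H.me _ ▷ H.X := by simp only [Category.assoc]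
    _ = (H.u _ ≫ H.d X ▷ H.X ≫ H.g _ ≫ H.m _ ▷ H.X) ▷ H.X ≫ H.b _ ≫ H.me X ▷ H.X := by
        rw [← m_b']
        simp [g]
    _ = _ := by
        rw [← m_d, reassoc_of% H.u_m']

end WeakHopfQuasigroup

/-! ### Comultiplication of products with a factor in H_L. -/

namespace WeakHopfQuasigroup

variable {C : Type u} [Category.{v} C] [MonoidalCategory C] [BraidedCategory C]
variable (H : WeakHopfQuasigroup C) (X : C)

/-- The natural transformation `h ⊗ k ↦ k₁ ε(h k₂)`. -/
def a : (X ⊗ H.X) ⊗ H.X ⟶ X ⊗ H.X := H.g X ≫ H.e _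

theorem a_eq : H.a X = H.d _ ≫ H.b X ▷ H.X ≫ H.me _ := by simp [a, g, me]

theorem P_eq_a : H.P X = H.u _ ≫ H.a X := by rw [P_eq_unit, a]

theorem d_b_d_b : H.d _ ≫ H.b X ▷ H.X ≫ H.d _ ▷ H.X ≫ H.b _ =
    H.d X ▷ H.X ≫ H.b _ ≫ H.d _ ▷ H.X ≫ H.b X ▷ H.X ▷ H.X := by
  calc _ = H.d _ ≫ (H.b X ≫ H.d _) ▷ H.X ≫ H.b _ := by simp
    _ = H.d X ▷ H.X ≫ (H.d _ ≫ H.b _ ▷ H.X ≫ H.b _) ≫ H.b X ▷ H.X ▷ H.X := by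
        rw [b_d]; simp
    _ = _ := by rw [← b_d']; simp

/-- `z₁ ⊗ h z₂ = z₁ ε(h₁ z₂) ⊗ h₂` for `z` in `H_L`. -/
theorem L_g : H.L _ ≫ H.g X = H.L _ ≫ H.d X ▷ H.X ≫ H.b _ ≫ H.a X ▷ H.X := by
  calc H.L _ ≫ H.g X = (H.L _ ≫ H.d _) ≫ H.b X ▷ H.X ≫ H.m _ := by simp [g]
    _ = H.L _ ≫ H.d _ ≫ H.b X ▷ H.X ≫ H.L _ ≫ H.m _ := by
        rw [← L_d_L]; simp
    _ = H.L _ ≫ (H.d _ ≫ H.b X ▷ H.X ≫ H.d _ ▷ H.X ≫ H.b _) ≫ H.me _ ▷ H.X := by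
        rw [L_m]; simp
    _ = _ := by rw [d_b_d_b, a_eq]; simp

/-- `ε(h 1₂) 1₁ ⊗ 1₃ = 1₁ ⊗ ε(h 1₂ 1'₁) 1'₂`. -/
theorem ud_a : H.ud _ ≫ H.a X ▷ H.X = H.u _ ≫ H.g X ≫ H.R _ := by
  calc _ = (H.ud _ ≫ H.d _ ▷ H.X) ≫ H.b X ▷ H.X ▷ H.X ≫ H.me _ ▷ H.X := by simp [a_eq]
    _ = H.ud _ ≫ H.b X ▷ H.X ≫ H.ud _ ≫ (H.m _ ▷ H.X ≫ H.me _ ) ▷ H.X := by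
        rw [ud_d', m_me]; simp
    _ = _ := by simp [ud, g, R]

theorem ud_m : H.ud X ▷ H.X ≫ H.g _ ≫ H.m _ ▷ H.X = H.d X := by
  rw [ud, comp_whiskerRight, Category.assoc, ← m_d, reassoc_of% H.u_m]

/-- `1₁ ⊗ 1₂ h = 1₁ ⊗ ε(1₂ h₁) h₂`. -/
theorem ud_m_eq : H.ud X ▷ H.X ≫ H.m _ = H.ud X ▷ H.X ≫ H.d _ ≫ H.me _ ▷ H.X := by
  calc _ = H.ud X ▷ H.X ≫ H.m _ ≫ H.d _ ≫ H.e _ ▷ H.X := by rw [d_e', Category.comp_id]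
    _ = (H.ud X ≫ H.d _) ▷ H.X ≫ H.g _ ≫ H.me _ ▷ H.X := by
        rw [reassoc_of% H.m_d]; simp [me]
    _ = (H.ud X ≫ H.d X ▷ H.X) ▷ H.X ≫ H.g _ ≫ H.me _ ▷ H.X := by rw [ud_d]
    _ = H.ud X ▷ H.X ≫ H.ud _ ▷ H.X ≫ H.g _ ≫ (H.m _ ▷ H.X ≫ H.me _) ▷ H.X := by
        rw [ud_d']; simp
    _ = H.ud X ▷ H.X ≫ (H.ud _ ▷ H.X ≫ H.g _ ≫ H.m _ ▷ H.X) ≫ H.me _ ▷ H.X := by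
        rw [m_me]; simp
    _ = _ := by rw [ud_m]

/-- `z h = ε(z h₁) h₂` for `z` in `H_L`. -/
theorem L_m' : H.L X ▷ H.X ≫ H.m X = H.L X ▷ H.X ≫ H.d _ ≫ H.me X ▷ H.X := by
  have : H.R X ▷ H.X ≫ H.m X = H.R X ▷ H.X ≫ H.d _ ≫ H.me X ▷ H.X := by
    calc _ = (H.ud _ ▷ H.X ≫ H.m _) ≫ H.me X ▷ H.X := by simp [R]
      _ = _ := by rw [ud_m_eq]; simp [R]
  rw [← L_R, comp_whiskerRight, Category.assoc, this]
  simp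

/-- `δ(z h) = z h₁ ⊗ h₂` for `z` in `H_L`. -/
theorem L_m_d : H.L X ▷ H.X ≫ H.m X ≫ H.d X = H.L X ▷ H.X ≫ H.d _ ≫ H.m X ▷ H.X := by
  calc _ = (H.L X ▷ H.X ≫ H.m X) ≫ H.d X := by simp
    _ = H.L X ▷ H.X ≫ (H.d _ ≫ H.d _) ≫ H.me X ▷ H.X ▷ H.X := by rw [L_m']; simp
    _ = H.d _ ≫ (H.L X ▷ H.X ≫ H.d _ ≫ H.me X ▷ H.X) ▷ H.X := by rw [← d_d]; simp
    _ = _ := by rw [← L_m']; simp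

/-- `k₁ ⊗ z k₂ = k₁ ε(z k₂) ⊗ k₃` for `z` in `H_L`. -/
theorem L_g' : H.L X ▷ H.X ≫ H.g X = H.L X ▷ H.X ≫ H.d _ ≫ H.a X ▷ H.X := by
  calc _ = H.d _ ≫ (H.L X ▷ H.X ▷ H.X ≫ H.b X ▷ H.X) ≫ H.m _ := by simp [g]
    _ = H.d _ ≫ H.b X ▷ H.X ≫ H.L _ ▷ H.X ≫ H.m _ := by
        rw [← comp_whiskerRight, ← b_L]; simp
    _ = H.d _ ≫ (H.b X ≫ H.L _) ▷ H.X ≫ H.d _ ≫ H.me _ ▷ H.X := by rw [L_m']; simp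
    _ = (H.d _ ≫ H.d _) ≫ H.L X ▷ H.X ▷ H.X ▷ H.X ≫ H.b X ▷ H.X ▷ H.X ≫ H.me _ ▷ H.X := by
        rw [b_L]; simp
    _ = _ := by rw [← d_d, a_eq]; simp

/-- `(z k)₁ ⊗ h (z k)₂ = z k₁ ⊗ h k₂` for `z` in `H_L`. -/
theorem L_m_g : H.L _ ▷ H.X ≫ H.m _ ≫ H.g X =
    H.L _ ▷ H.X ≫ H.b X ▷ H.X ≫ H.g _ ≫ H.m X ▷ H.X := by
  calc _ = (H.L _ ▷ H.X ≫ H.m _ ≫ H.d _) ≫ H.b X ▷ H.X ≫ H.m _ := by simp [g]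
    _ = H.L _ ▷ H.X ≫ H.d _ ≫ (H.m _ ≫ H.b X) ▷ H.X ≫ H.m _ := by rw [L_m_d]; simp
    _ = _ := by rw [m_b]; simp [g]

end WeakHopfQuasigroup

namespace HopfModule

variable {C : Type u} [Category.{v} C] [MonoidalCategory C] [BraidedCategory C]
  {H : WeakHopfQuasigroup C}

/-- `ρ(m z) = m₀ z ⊗ m₁` for `z` in `H_L`. -/
theorem L_act_coact_aux {X : C} (φ : X ⊗ H.X ⟶ X) (r : X ⟶ X ⊗ H.X) (h₁ : r ≫ H.e _ = 𝟙 _)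
    (h₂ : r ≫ H.d _ = r ≫ r ▷ H.X) (h₃ : φ ≫ r = r ▷ H.X ≫ H.g _ ≫ φ ▷ H.X) :
    H.L _ ≫ φ ≫ r = H.L _ ≫ r ▷ H.X ≫ H.b _ ≫ φ ▷ H.X := by
  calc _ = r ▷ H.X ≫ (H.L _ ≫ H.g _) ≫ φ ▷ H.X := by rw [h₃]; simp
    _ = (r ≫ H.d _) ▷ H.X ≫ H.L _ ≫ H.b _ ≫ H.a _ ▷ H.X ≫ φ ▷ H.X := by
        rw [WeakHopfQuasigroup.L_g]; simp
    _ = H.L _ ≫ r ▷ H.X ≫ H.b _ ≫ ((r ▷ H.X ≫ H.g _ ≫ φ ▷ H.X) ≫ H.e _) ▷ H.X := by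
        rw [h₂]; simp [WeakHopfQuasigroup.a]
    _ = _ := by rw [← h₃, Category.assoc, h₁, Category.comp_id]

end HopfModule

/-! ### Associativity with a factor in H_L, and the coproduct of the antipode. -/

namespace WeakHopfQuasigroup

variable {C : Type u} [Category.{v} C] [MonoidalCategory C] [BraidedCategory C]
variable (H : WeakHopfQuasigroup C) (X : C)

/-- `(h z) k = h (z k)` for `z` in `H_L`. -/
theorem L_m_m : H.L _ ▷ H.X ≫ H.m X ▷ H.X ≫ H.m X = H.L _ ▷ H.X ≫ H.m _ ≫ H.m X := by
  -- Inserting (ε ⊗ H)δ moves the rebracketing under ε, where it is an axiom: (hz)k = ε((h₁z)k₁)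
  -- h₂k₂ = ε(h₁(zk₁)) h₂k₂ = h(zk).
  calc _ = H.L _ ▷ H.X ≫ H.m X ▷ H.X ≫ H.m X ≫ H.d X ≫ H.e X ▷ H.X := by
        rw [d_e', Category.comp_id]
    _ = (H.L _ ≫ H.m X ≫ H.d X) ▷ H.X ≫ H.g _ ≫ H.me X ▷ H.X := by
        rw [reassoc_of% H.m_d]; simp [me]
    -- `L_act_coact_aux` assumes only a bare action and coaction, so it applies to X ⊗ H with `m`
    -- and `d`, giving δ(hz) = h₁z ⊗ h₂.
    _ = (H.L _ ≫ H.d X ▷ H.X ≫ H.b _) ▷ H.X ≫ H.g _ ≫ (H.m X ▷ H.X ≫ H.me X) ▷ H.X := by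
        rw [HopfModule.L_act_coact_aux _ _ (H.d_e X) (H.d_d X).symm (H.m_d X)]; simp
    _ = H.d X ▷ H.X ▷ H.X ≫ (H.L _ ▷ H.X ≫ H.b _ ▷ H.X ≫ H.g _ ≫ H.m _ ▷ H.X) ≫
        H.me X ▷ H.X := by
        rw [m_me]; simp
    _ = H.L _ ▷ H.X ≫ H.m _ ≫ (H.d X ▷ H.X ≫ H.g _ ≫ H.m X ▷ H.X) ≫ H.e X ▷ H.X := by
        rw [← L_m_g]; simp [me]
    _ = _ := by rw [← m_d, Category.assoc, d_e', Category.comp_id]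

/-- `(z h) k = z (h k)` for `z` in `H_L`. -/
theorem L_m_m' : H.L X ▷ H.X ▷ H.X ≫ H.m X ▷ H.X ≫ H.m X =
    H.L X ▷ H.X ▷ H.X ≫ H.m _ ≫ H.m X := by
  symm
  calc _ = H.m _ ≫ H.L X ▷ H.X ≫ H.m X := by simp
    _ = H.L X ▷ H.X ▷ H.X ≫ (H.m _ ≫ H.d _) ≫ H.me X ▷ H.X := by rw [L_m']; simp
    _ = (H.L X ▷ H.X ≫ H.d _) ▷ H.X ≫ H.g _ ≫ (H.m _ ▷ H.X ≫ H.me X) ▷ H.X := by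
        rw [m_d, m_me]; simp [me]
    _ = (H.L X ▷ H.X ≫ H.d _ ≫ H.m _ ▷ H.X) ▷ H.X ≫ H.g _ ≫ H.me X ▷ H.X := by
        rw [m_me]; simp [← m_me]
    _ = H.L X ▷ H.X ▷ H.X ≫ H.m X ▷ H.X ≫ (H.d X ▷ H.X ≫ H.g _ ≫ H.m X ▷ H.X) ≫
        H.e X ▷ H.X := by
        rw [← L_m_d]; simp [me]
    _ = _ := by rw [← m_d, Category.assoc, d_e', Category.comp_id]

/-- `k₁ ⊗ (h z) k₂ = k₁ ⊗ h (z k₂)` for `z` in `H_L`. -/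
theorem m_g : H.L _ ▷ H.X ≫ H.m X ▷ H.X ≫ H.g X =
    H.L _ ▷ H.X ≫ H.g _ ≫ H.b X ▷ H.X ≫ H.m _ := by
  calc _ = H.d _ ≫ H.L _ ▷ H.X ▷ H.X ≫ (H.m X ▷ H.X ≫ H.b X) ▷ H.X ≫ H.m _ := by simp [g]
    _ = H.d _ ≫ (H.L _ ▷ H.X ≫ H.b _) ▷ H.X ≫ H.b _ ▷ H.X ▷ H.X ≫ H.m _ ▷ H.X ≫ H.m _ := by
        rw [m_b']; simp
    _ = H.d _ ≫ H.b _ ▷ H.X ≫ H.b _ ▷ H.X ▷ H.X ≫ H.L _ ▷ H.X ≫ H.m _ ▷ H.X ≫ H.m _ := by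
        rw [← b_L]; simp
    _ = H.d _ ≫ (H.b _ ≫ H.L _) ▷ H.X ≫ H.b _ ▷ H.X ▷ H.X ≫ H.m _ ≫ H.m _ := by
        rw [L_m_m]; simp
    _ = _ := by rw [b_L]; simp [g]

/-- `Π^R(h₁) ⊗ h₂ = 1₁ ⊗ h 1₂`. -/
theorem d_P : H.d X ≫ H.P X ▷ H.X = H.u _ ≫ H.g X := by
  symm
  calc _ = (H.u _ ≫ H.L _) ≫ H.g X := by rw [u_L]
    _ = H.u _ ≫ H.d X ▷ H.X ≫ H.b _ ≫ H.a X ▷ H.X := by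
        rw [Category.assoc, L_g, reassoc_of% H.u_L]
    _ = H.d X ≫ (H.u _ ≫ H.b _) ≫ H.a X ▷ H.X := by simp
    _ = _ := by rw [u_b, P_eq_a]; simp

/-- `Π^R(h₁) k₁ ⊗ h₂ k₂ = k₁ ⊗ h k₂`. -/
theorem d_P_g_m : H.d X ▷ H.X ≫ H.P X ▷ H.X ▷ H.X ≫ H.g _ ≫ H.m X ▷ H.X = H.g X := by
  calc _ = (H.d X ≫ H.P X ▷ H.X) ▷ H.X ≫ H.g _ ≫ H.m X ▷ H.X := by simp
    -- By `d_P` the expression is 1₁k₁ ⊗ (h1₂)k₂. As 1₂ lies in H_L, this equals 1₁k₁ ⊗ h(1₂k₂), and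
    -- δ(1k) = δ(k) finishes.
    _ = (H.ud _ ≫ H.b X ▷ H.X) ▷ H.X ≫ H.m _ ▷ H.X ≫ H.g _ ≫ H.m X ▷ H.X := by
        rw [d_P]; simp [g, ud]
    _ = (H.ud _ ≫ H.L _) ▷ H.X ≫ H.b X ▷ H.X ▷ H.X ≫ H.m _ ▷ H.X ≫ H.g _ ≫ H.m X ▷ H.X := by
        rw [ud_L]; simp
    _ = H.ud _ ▷ H.X ≫ H.b X ▷ H.X ▷ H.X ≫ (H.L _ ▷ H.X ≫ H.m _ ▷ H.X ≫ H.g _) ≫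
        H.m X ▷ H.X := by simp
    _ = (H.ud _ ≫ H.L _) ▷ H.X ≫ H.g _ ≫ (H.b _ ▷ H.X ≫ H.b _ ≫ H.m X ▷ H.X) ▷ H.X ≫
        H.m _ := by
        rw [m_g]; simp
    _ = (H.ud _ ▷ H.X ≫ H.g _ ≫ H.m _ ▷ H.X) ≫ H.b X ▷ H.X ≫ H.m _ := by
        rw [ud_L, ← m_b]; simp
    _ = _ := by rw [ud_m, g]

/-- `antipode(h₂)₁ ⊗ h₁ antipode(h₂)₂` lies in `H ⊗ H_L`. -/
theorem d_s_g_L : H.d X ≫ H.s _ ≫ H.g X ≫ H.L _ = H.d X ≫ H.s _ ≫ H.g X := by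
  have h₁ (X : C) : H.L X ≫ H.d X = H.d X ≫ (H.d _ ≫ H.s _ ≫ H.g _) ≫ H.m X ▷ H.X := by
    calc _ = H.d X ≫ H.s _ ≫ H.m X ≫ H.d X := by simp [L_eq]
      _ = (H.d X ≫ H.d X ▷ H.X) ≫ H.s _ ≫ H.g _ ≫ H.m X ▷ H.X := by rw [m_d]; simp
      _ = _ := by rw [d_d]; simp
  -- This rewrites λ(h₂)₁ ⊗ h₁λ(h₂)₂ as λ(h₁)Π^L(h₂)₁ ⊗ Π^L(h₂)₂, whose last leg is visibly in H_L.
  -- Expanding δ(Π^L(h₂)) by `h₁` produces λ(h₁)(h₂ –), which the antipode axiom turns into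
  -- Π^R(h₁)(–) and `d_P_g_m` absorbs.
  have h₂ : H.d X ≫ H.s _ ≫ H.g X = H.d X ≫ H.s X ▷ H.X ≫ H.L _ ≫ H.d _ ≫ H.m X ▷ H.X := by
    symm
    calc _ = H.d X ≫ H.s X ▷ H.X ≫ (H.L _ ≫ H.d _) ≫ H.m X ▷ H.X := by simp
      _ = (H.d X ≫ H.d _) ≫ (H.d _ ≫ H.s _ ≫ H.g _) ≫
          (H.s X ▷ H.X ▷ H.X ≫ H.m _ ≫ H.m X) ▷ H.X := by rw [h₁]; simp
      _ = H.d X ≫ (H.d _ ≫ H.s _ ≫ H.g _) ≫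
          (H.d X ▷ H.X ≫ H.s X ▷ H.X ▷ H.X ≫ H.m _ ≫ H.m X) ▷ H.X := by rw [← d_d]; simp
      _ = (H.d X ≫ H.d _) ≫ H.P X ▷ H.X ▷ H.X ≫ H.s _ ≫ H.g _ ≫ H.m X ▷ H.X := by
          rw [s_m_m]; simp
      _ = H.d X ≫ H.s _ ≫ H.d X ▷ H.X ≫ H.P X ▷ H.X ▷ H.X ≫ H.g _ ≫ H.m X ▷ H.X := by
          rw [← d_d]; simp
      _ = _ := by rw [d_P_g_m]
  calc _ = (H.d X ≫ H.s _ ≫ H.g X) ≫ H.L _ := by simp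
    _ = H.d X ≫ H.s X ▷ H.X ≫ (H.L _ ≫ H.d _ ≫ H.L _) ≫ H.m X ▷ H.X := by rw [h₂]; simp
    _ = _ := by rw [L_d_L, h₂]; simp

end WeakHopfQuasigroup

/-! ### The splitting H_L of Π^L. -/

namespace WeakHopfQuasigroup

variable {C : Type u} [Category.{v} C] [MonoidalCategory C] [BraidedCategory C]
variable (H : WeakHopfQuasigroup C) (X : C)

/-- With Π^L(h) = ε(1₁h)1₂ the left side is ε(1₁h₁) 1₂h₂, that is, (ε ⊗ H)δ(1h). -/
theorem d_L_m : H.d X ≫ H.L X ▷ H.X ≫ H.m X = 𝟙 _ := by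
  calc _ = H.u X ▷ H.X ≫ (H.d X ▷ H.X ≫ H.g _ ≫ H.m X ▷ H.X) ≫ H.e X ▷ H.X := by
        simp [L_eq_ud, g, me, ud]
    _ = _ := by rw [← m_d, Category.assoc, d_e', Category.comp_id, u_m]

theorem L_me : H.L _ ≫ H.me X = H.me X := by
  calc _ = (H.L _ ≫ H.m X) ≫ H.e X := by simp [me]
    _ = H.d X ▷ H.X ≫ (H.b _ ≫ H.e _) ≫ H.me X := by rw [L_m]; simp
    _ = _ := by rw [b_e, ← comp_whiskerRight_assoc, d_e, id_whiskerRight, Category.id_comp]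

/-- Π^L(hk) depends on k only through ε(1₁(hk)) = ε((1₁h)k), and ε does not distinguish k from
Π^L(k). This is what makes n ⊗ h ↦ n p_L(h) balanced over H_L. -/
theorem m_L : H.m X ≫ H.L X = H.L _ ≫ H.m X ≫ H.L X := by
  have : H.m X ≫ H.L X = H.ud X ▷ H.X ▷ H.X ≫ H.b _ ▷ H.X ≫ H.b _ ≫
      H.m _ ▷ H.X ▷ H.X ≫ H.me X ▷ H.X := by
    calc _ = H.ud X ▷ H.X ▷ H.X ≫ (H.m _ ≫ H.b _) ≫ H.me X ▷ H.X := by simp [L_eq_ud]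
      _ = H.ud X ▷ H.X ▷ H.X ≫ H.b _ ▷ H.X ≫ H.b _ ≫ (H.m _ ≫ H.me X) ▷ H.X := by
          rw [m_b]; simp
      _ = _ := by rw [← m_me]; simp
  rw [this]
  symm
  calc _ = H.ud X ▷ H.X ▷ H.X ≫ H.b _ ▷ H.X ≫ (H.L _ ≫ H.b _) ≫
      H.m _ ▷ H.X ▷ H.X ≫ H.me X ▷ H.X := by simp
    _ = H.ud X ▷ H.X ▷ H.X ≫ H.b _ ▷ H.X ≫ H.b _ ≫
      (H.m _ ▷ H.X ≫ H.L _ ≫ H.me X) ▷ H.X := by rw [← b_L']; simp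
    _ = _ := by rw [L_me]; simp

theorem PiL_comp_PiL : H.PiL ≫ H.PiL = H.PiL := by
  have := H.L_L (𝟙_ C)
  rw [L, ← MonoidalCategory.whiskerLeft_comp] at this
  exact (whiskerLeft_iff _ _).1 this

variable [IsIdempotentComplete C]

/-- The inclusion of `H_L` into `H`, as a natural transformation. -/
noncomputable def j : X ⊗ H.HL ⟶ X ⊗ H.X := X ◁ H.iL

/-- The projection of `H` onto `H_L`, as a natural transformation. -/
noncomputable def k : X ⊗ H.X ⟶ X ⊗ H.HL := X ◁ H.pL

theorem iL_pL : H.iL ≫ H.pL = 𝟙 _ := idemIncl_comp_idemProj _ H.PiL_comp_PiL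

theorem pL_iL : H.pL ≫ H.iL = H.PiL := idemProj_comp_idemIncl _

theorem j_k : H.j X ≫ H.k X = 𝟙 _ := by
  rw [j, k, ← MonoidalCategory.whiskerLeft_comp, iL_pL, MonoidalCategory.whiskerLeft_id]

theorem k_j : H.k X ≫ H.j X = H.L X := by
  rw [j, k, ← MonoidalCategory.whiskerLeft_comp, pL_iL, L]

theorem j_L : H.j X ≫ H.L X = H.j X := by rw [← k_j, reassoc_of% H.j_k]

theorem L_k : H.L X ≫ H.k X = H.k X := by rw [← k_j, Category.assoc, j_k, Category.comp_id]

variable {X} in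
theorem j_nat {Y : C} (f : X ⟶ Y) : f ▷ H.HL ≫ H.j Y = H.j X ≫ f ▷ H.X :=
  (whisker_exchange _ _).symm

variable {X} in
theorem k_nat {Y : C} (f : X ⟶ Y) : f ▷ H.X ≫ H.k Y = H.k X ≫ f ▷ H.HL :=
  (whisker_exchange _ _).symm

/-- Since p_L is a split epimorphism, identities over H_L can be proved on H with Π^L inserted,
where the structure maps of H are available. -/
theorem whisker_L_comp_eq_iff {Y : C} (f f' : (X ⊗ H.X) ⊗ H.X ⟶ Y) :
    H.L X ▷ H.X ≫ f = H.L X ▷ H.X ≫ f' ↔ H.j X ▷ H.X ≫ f = H.j X ▷ H.X ≫ f' := by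
  constructor
  · intro h
    rw [← H.j_L, comp_whiskerRight, Category.assoc, h, Category.assoc]
  · intro h
    rw [← H.k_j, comp_whiskerRight, Category.assoc, h, Category.assoc]

end WeakHopfQuasigroup

/-! ### Coinvariants of a Hopf module and the transported action. -/

namespace HopfModule

open WeakHopfQuasigroup

variable {C : Type u} [Category.{v} C] [MonoidalCategory C] [BraidedCategory C]
  {H : WeakHopfQuasigroup C}

/-- A Hopf module, constructed from identities between natural transformations. -/
def ofNat (X : C) (φ : X ⊗ H.X ⟶ X) (r : X ⟶ X ⊗ H.X) (h₁ : r ≫ H.e _ = 𝟙 _)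
    (h₂ : r ≫ r ▷ H.X = r ≫ H.d _) (h₃ : H.u _ ≫ φ = 𝟙 _)
    (h₄ : φ ≫ r = r ▷ H.X ≫ H.g _ ≫ φ ▷ H.X)
    (h₅ : H.d _ ≫ φ ▷ H.X ≫ H.s _ ≫ φ = H.L _ ≫ φ)
    (h₆ : H.d _ ≫ H.s _ ▷ H.X ≫ φ ▷ H.X ≫ φ = H.P _ ≫ φ)
    (h₇ : H.d _ ≫ H.L _ ▷ H.X ≫ φ ▷ H.X ≫ φ = φ) : HopfModule H where
  X := X
  act := φ
  coact := r
  coact_counit := by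
    rw [← cancel_mono (ρ_ X).hom, Category.assoc, Iso.inv_hom_id]
    exact h₁
  coact_coact := h₂
  act_one := by
    rw [← cancel_epi (ρ_ X).inv, Iso.inv_hom_id, ← h₃, u, Category.assoc]
  act_coact := by
    rw [h₄]
    simp only [m, d, b, g, tensorμ, MonoidalCategory.tensorHom_def r,
      MonoidalCategory.tensorHom_def' φ]
    monoidal
  act_act_antipode := by
    refine Eq.trans ?_ h₅
    simp only [d, s, MonoidalCategory.tensorHom_def]
    monoidal
  act_antipode_act := by
    refine Eq.trans ?_ h₆
    simp only [d, s]
    monoidal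
  act_target_act := by
    refine Eq.trans ?_ h₇
    simp only [d, L]
    monoidal

variable (M : HopfModule H)

/-- As Π^R(h) = 1₁ ε(h1₂), the left side is (M ⊗ ε)ρ(m1). -/
theorem coact_P_act : M.coact ≫ H.P _ ≫ M.act = 𝟙 _ := by
  calc _ = H.u _ ≫ (M.coact ▷ H.X ≫ H.g _ ≫ M.act ▷ H.X) ≫ H.e _ := by
        simp [P_eq_a, a]
    _ = _ := by
        rw [← M.act_comp_coact, Category.assoc, M.coact_e, Category.comp_id, M.u_act]

theorem q_eq : M.q = M.coact ≫ H.s _ ≫ M.act := rfl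

theorem coact_q_act : M.coact ≫ M.q ▷ H.X ≫ M.act = 𝟙 _ := by
  calc _ = (M.coact ≫ M.coact ▷ H.X) ≫ H.s _ ▷ H.X ≫ M.act ▷ H.X ≫ M.act := by
        simp [q_eq]
    _ = _ := by rw [← M.coact_d, Category.assoc, M.s_act_act, coact_P_act]

/-- `m 1₁ ⊗ 1₂ = m₀ ⊗ ε(m₁ 1₁) 1₂`. -/
theorem ud_act : H.ud _ ≫ M.act ▷ H.X = M.coact ≫ H.R _ := by
  calc _ = H.ud _ ≫ (M.act ≫ M.coact ≫ H.e _) ▷ H.X := by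
        rw [M.coact_e, Category.comp_id]
    _ = H.ud _ ≫ ((M.coact ▷ H.X ≫ H.g _ ≫ M.act ▷ H.X) ≫ H.e _) ▷ H.X := by
        rw [← M.act_comp_coact]; simp
    _ = M.coact ≫ (H.ud _ ≫ H.a _ ▷ H.X) ≫ M.act ▷ H.X := by simp [a]
    _ = H.u _ ≫ (M.coact ▷ H.X ≫ H.g _ ≫ M.act ▷ H.X) ≫ H.R _ := by
        rw [H.ud_a]; simp
    _ = _ := by rw [← M.act_comp_coact, Category.assoc, reassoc_of% M.u_act]

/-- A morphism with values in the coinvariants of `M`. -/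
def IsCoinv {Z : C} (f : Z ⟶ M.X) : Prop := f ≫ M.coact ≫ H.L _ = f ≫ M.coact

variable {M}

/-- If ρ(n) lies in M ⊗ H_L then `R` fixes its second leg, so `ud_act` gives ρ(n) = n1₁ ⊗ 1₂. Then
q(n) = (n1₁)λ(1₂) = nΠ^L(1) = n. -/
theorem IsCoinv.comp_q {Z : C} {f : Z ⟶ M.X} (hf : M.IsCoinv f) : f ≫ M.q = f := by
  have h : f ≫ M.coact = f ≫ H.ud _ ≫ M.act ▷ H.X := by
    have hf' : f ≫ M.coact ≫ H.L _ = f ≫ M.coact := hf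
    rw [ud_act, ← reassoc_of% hf', H.L_R, hf']
  calc _ = (f ≫ M.coact) ≫ H.s _ ≫ M.act := by simp [q_eq]
    _ = f ≫ H.u _ ≫ H.d _ ≫ M.act ▷ H.X ≫ H.s _ ≫ M.act := by
        rw [h]; simp only [ud, Category.assoc]
    _ = f := by
        rw [M.act_s_act, reassoc_of% H.u_L, M.u_act, Category.comp_id]

-- ρ(q(m)) is m₀ λ(m₂)₁ ⊗ m₁ λ(m₂)₂, so `d_s_g_L` places its last leg in H_L.
variable (M) in
theorem isCoinv_q : M.IsCoinv M.q := by
  have h : M.q ≫ M.coact = M.coact ≫ (H.d _ ≫ H.s _ ≫ H.g _) ≫ M.act ▷ H.X := by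
    calc _ = M.coact ≫ H.s _ ≫ M.act ≫ M.coact := by simp [q_eq]
      _ = (M.coact ≫ M.coact ▷ H.X) ≫ H.s _ ≫ H.g _ ≫ M.act ▷ H.X := by
          rw [M.act_comp_coact]; simp
      _ = _ := by rw [← M.coact_d]; simp
  calc _ = (M.q ≫ M.coact) ≫ H.L _ := by simp
    _ = M.coact ≫ (H.d _ ≫ H.s _ ≫ H.g _ ≫ H.L _) ≫ M.act ▷ H.X := by rw [h]; simp
    _ = _ := by rw [H.d_s_g_L, ← h]

variable (M) in
theorem q_comp_q : M.q ≫ M.q = M.q := M.isCoinv_q.comp_q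

theorem isCoinv_of_comp_q {Z : C} {f : Z ⟶ M.X} (hf : f ≫ M.q = f) : M.IsCoinv f := by
  rw [← hf]
  simpa [IsCoinv] using congrArg (f ≫ ·) M.isCoinv_q

variable (M) in
theorem L_act_coact : H.L _ ≫ M.act ≫ M.coact = H.L _ ≫ M.coact ▷ H.X ≫ H.b _ ≫ M.act ▷ H.X :=
  L_act_coact_aux _ _ M.coact_e M.coact_d M.act_comp_coact

/-- If `n` is coinvariant and `z` lies in `H_L`, then `n z` is coinvariant. -/
theorem IsCoinv.act {Z : C} {f : Z ⟶ M.X} (hf : M.IsCoinv f) :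
    M.IsCoinv (f ▷ H.X ≫ H.L _ ≫ M.act) := by
  have hf' : f ≫ M.coact ≫ H.L _ = f ≫ M.coact := hf
  have h : f ▷ H.X ≫ H.L _ ≫ M.act ≫ M.coact =
      H.L _ ≫ (f ≫ M.coact) ▷ H.X ≫ H.b _ ≫ M.act ▷ H.X := by
    rw [M.L_act_coact]; simp
  calc _ = (f ▷ H.X ≫ H.L _ ≫ M.act ≫ M.coact) ≫ H.L _ := by simp only [Category.assoc]
    _ = H.L _ ≫ (f ≫ M.coact) ▷ H.X ≫ (H.b _ ≫ H.L _) ≫ M.act ▷ H.X := by rw [h]; simp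
    _ = H.L _ ≫ (f ≫ M.coact ≫ H.L _) ▷ H.X ≫ H.b _ ≫ M.act ▷ H.X := by rw [H.b_L]; simp
    _ = _ := by rw [hf', ← h]; simp only [Category.assoc]

/-- If `n` is coinvariant, then `ρ(n h) = n h₁ ⊗ h₂`. -/
theorem IsCoinv.act_coact {Z : C} {f : Z ⟶ M.X} (hf : M.IsCoinv f) :
    f ▷ H.X ≫ M.act ≫ M.coact = f ▷ H.X ≫ H.d _ ≫ M.act ▷ H.X := by
  have hf' : f ≫ M.coact ≫ H.L _ = f ≫ M.coact := hf
  calc _ = (f ≫ M.coact) ▷ H.X ≫ H.g _ ≫ M.act ▷ H.X := by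
        rw [M.act_comp_coact]; simp
    _ = f ▷ H.X ≫ M.coact ▷ H.X ≫ (H.L _ ▷ H.X ≫ H.g _) ≫ M.act ▷ H.X := by
        rw [← hf']; simp
    _ = (f ≫ M.coact ≫ H.L _) ▷ H.X ≫ H.d _ ≫ H.a _ ▷ H.X ≫ M.act ▷ H.X := by
        rw [H.L_g']; simp
    _ = f ▷ H.X ≫ H.d _ ≫ ((M.coact ▷ H.X ≫ H.g _ ≫ M.act ▷ H.X) ≫ H.e _) ▷ H.X := by
        rw [hf']; simp [a]
    _ = _ := by rw [← M.act_comp_coact, Category.assoc, M.coact_e, Category.comp_id]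

/-- From ρ(nh) = nh₁ ⊗ h₂ one gets q(nh) = (nh₁)λ(h₂), which a Hopf module axiom collapses. -/
theorem IsCoinv.act_q {Z : C} {f : Z ⟶ M.X} (hf : M.IsCoinv f) :
    f ▷ H.X ≫ M.act ≫ M.q = f ▷ H.X ≫ H.L _ ≫ M.act := by
  calc _ = (f ▷ H.X ≫ M.act ≫ M.coact) ≫ H.s _ ≫ M.act := by simp [q_eq]
    _ = f ▷ H.X ≫ H.d _ ≫ M.act ▷ H.X ≫ H.s _ ≫ M.act := by rw [hf.act_coact]; simp
    _ = _ := by rw [M.act_s_act]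

variable [IsIdempotentComplete C]

variable (M) in
theorem p_i : M.p ≫ M.i = M.q := idemProj_comp_idemIncl _

variable (M) in
theorem i_p : M.i ≫ M.p = 𝟙 _ := idemIncl_comp_idemProj _ M.q_comp_q

variable (M) in
theorem i_q : M.i ≫ M.q = M.i := by rw [← M.p_i, reassoc_of% M.i_p]

variable (M) in
theorem isCoinv_i : M.IsCoinv M.i := isCoinv_of_comp_q M.i_q

variable (M) in
theorem omega'_omega : M.omega' ≫ M.omega = 𝟙 _ := by
  rw [omega', omega, Category.assoc, ← comp_whiskerRight_assoc, M.p_i, M.coact_q_act]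

variable (M) in
theorem actAlpha_eq : M.actAlpha = M.coact ▷ H.X ≫ H.m _ ≫ M.q ▷ H.X ≫ M.act := by
  -- Only the composite `pr ≫ inc` matters, so the chosen splitting of ∇_M is irrelevant; both
  -- copies of ∇_M cancel against `omega'_omega`.
  have h {T : C} (pr : M.coinv ⊗ H.X ⟶ T) (inc : T ⟶ M.coinv ⊗ H.X)
      (h : pr ≫ inc = M.omega ≫ M.omega') :
      (M.omega' ≫ pr) ▷ H.X ≫ (inc ▷ H.X ≫ (α_ _ _ _).hom ≫ _ ◁ H.mul ≫ pr) ≫ inc ≫ M.omega =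
        M.coact ▷ H.X ≫ H.m _ ≫ M.q ▷ H.X ≫ M.act := by
    calc _ = (M.omega' ≫ pr ≫ inc) ▷ H.X ≫ H.m _ ≫ (pr ≫ inc) ≫ M.omega := by simp [m]
      _ = (M.omega' ≫ M.omega ≫ M.omega') ▷ H.X ≫ H.m _ ≫ M.omega ≫ M.omega' ≫ M.omega := by
          rw [h, Category.assoc]
      _ = M.omega' ▷ H.X ≫ H.m _ ≫ M.omega := by
          rw [reassoc_of% M.omega'_omega, M.omega'_omega, Category.comp_id]
      _ = _ := by
          rw [← p_i]
          simp [omega', omega]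
  exact h _ _ (idemProj_comp_idemIncl _)

theorem isStrong_iff : IsStrong H M ↔
    H.L _ ▷ H.X ≫ M.act ▷ H.X ≫ M.act = H.L _ ▷ H.X ≫ H.m _ ≫ M.act := by
  rw [whisker_L_comp_eq_iff]
  simp [IsStrong, j, m, phiL]

/-- A Hopf module morphism commutes with the projections onto the coinvariants. -/
theorem coact_s_actAlpha : M.coact ≫ H.s _ ≫ M.actAlpha = M.q := by
  -- In elements: q(m₀)(m₁λ(m₂)) = q(m₀)Π^L(m₁) = (q(m₀)m₁)λ(m₂) = m₀λ(m₁). So q is expressed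
  -- through the coaction and the action that morphisms preserve.
  calc _ = (M.coact ≫ M.coact ▷ H.X) ≫ H.s _ ≫ H.m _ ≫ M.q ▷ H.X ≫ M.act := by
        rw [actAlpha_eq]; simp
    _ = M.coact ≫ (H.d _ ≫ H.s _ ≫ H.m _) ≫ M.q ▷ H.X ≫ M.act := by
        rw [← M.coact_d]; simp
    _ = M.coact ≫ M.q ▷ H.X ≫ H.L _ ≫ M.act := by rw [← H.L_eq]; simp
    _ = (M.coact ≫ H.d _) ≫ M.q ▷ H.X ▷ H.X ≫ M.act ▷ H.X ≫ H.s _ ≫ M.act := by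
        rw [← M.act_s_act]; simp
    _ = M.coact ≫ (M.coact ≫ M.q ▷ H.X ≫ M.act) ▷ H.X ≫ H.s _ ≫ M.act := by
        rw [M.coact_d]; simp
    _ = _ := by rw [M.coact_q_act, id_whiskerRight, Category.id_comp, q_eq]

/-- On the coinvariants of a strong Hopf module the actions `φ_M` and `φ_M^{α_M}` agree. -/
theorem IsCoinv.actAlpha {Z : C} {f : Z ⟶ M.X} (hf : M.IsCoinv f) (hM : IsStrong H M) :
    f ▷ H.X ≫ M.actAlpha = f ▷ H.X ≫ M.act := by
  have hf' : f ≫ M.coact ≫ H.L _ = f ≫ M.coact := hf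
  rw [isStrong_iff] at hM
  -- The transported action sends n ⊗ h to q(n₀)(n₁h). As n₁ lies in H_L, strongness rebrackets this
  -- to (q(n₀)n₁)h = nh.
  calc _ = (f ≫ M.coact ≫ H.L _) ▷ H.X ≫ H.m _ ≫ M.q ▷ H.X ≫ M.act := by
        rw [actAlpha_eq, hf']; simp
    _ = (f ≫ M.coact ≫ M.q ▷ H.X) ▷ H.X ≫ H.L _ ▷ H.X ≫ H.m _ ≫ M.act := by simp
    _ = (f ≫ M.coact ≫ H.L _) ▷ H.X ≫ M.q ▷ H.X ▷ H.X ≫ M.act ▷ H.X ≫ M.act := by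
        rw [← hM]; simp
    _ = f ▷ H.X ≫ (M.coact ≫ M.q ▷ H.X ≫ M.act) ▷ H.X ≫ M.act := by
        rw [hf']; simp
    _ = _ := by rw [M.coact_q_act, id_whiskerRight, Category.id_comp]

end HopfModule

/-! ### The induction functor. -/

namespace RightHLModule

open WeakHopfQuasigroup

variable {C : Type u} [Category.{v} C] [MonoidalCategory C] [BraidedCategory C]
  [IsIdempotentComplete C] {H : WeakHopfQuasigroup C}

section

variable (N : RightHLModule H)

/-- The action of `H_L` on `N`, extended to `H` along the projection `H ⟶ H_L`. -/
noncomputable def actH : N.X ⊗ H.X ⟶ N.X := H.k _ ≫ N.act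

theorem L_actH : H.L _ ≫ N.actH = N.actH := by rw [actH, reassoc_of% H.L_k]

theorem u_actH : H.u _ ≫ N.actH = 𝟙 _ := by
  calc _ = (ρ_ N.X).inv ≫ N.X ◁ H.oneL ≫ N.act := by simp [actH, u, k, oneL]
    _ = _ := by rw [N.act_one, Iso.inv_hom_id]

theorem act_actH : N.act ▷ H.X ≫ N.actH = H.j _ ▷ H.X ≫ H.m _ ≫ N.actH := by
  symm
  calc _ = H.j _ ▷ H.X ≫ (H.m _ ≫ H.L _) ≫ N.actH := by rw [Category.assoc, L_actH]
    _ = H.j _ ▷ H.X ≫ H.L _ ≫ H.m _ ≫ N.actH := by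
        rw [m_L]; simp only [Category.assoc]; rw [L_actH]
    _ = H.k _ ≫ (H.j _ ▷ H.HL ≫ H.j _ ≫ H.m _ ≫ H.k _) ≫ N.act := by
        rw [← k_j, Category.assoc, reassoc_of% H.k_nat]; simp only [Category.assoc, actH]
    _ = H.k _ ≫ ((α_ _ _ _).hom ≫ N.X ◁ H.mulL) ≫ N.act := by
        congr 2
        simp only [j, m, k, mulL, MonoidalCategory.tensorHom_def]
        monoidal
    _ = _ := by
        rw [Category.assoc, N.act_mul, Iso.hom_inv_id_assoc, actH, reassoc_of% H.k_nat]

end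

section

variable (N : RightHLModule H)

/-- The morphism `n : N ⊗ H ⟶ Q` is a coequalizer of `ψ_N ⊗ H` and `N ⊗ (μ_H ∘ (i_L ⊗ H))`. -/
def IsTensor {Q : C} (n : N.X ⊗ H.X ⟶ Q) : Prop :=
  ∃ w : N.act ▷ H.X ≫ n = ((α_ N.X H.HL H.X).hom ≫ N.X ◁ H.phiL) ≫ n,
    Nonempty (IsColimit (Cofork.ofπ n w))

theorem phiL_eq : (α_ N.X H.HL H.X).hom ≫ N.X ◁ H.phiL = H.j _ ▷ H.X ≫ H.m _ := by
  simp [j, m, phiL]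

theorem exists_isTensor [HasCoequalizers C] : ∃ (Q : C) (n : N.X ⊗ H.X ⟶ Q), N.IsTensor n :=
  ⟨_, _, coequalizer.condition _ _, ⟨coequalizerIsCoequalizer _ _⟩⟩

variable {N} {Q : C} {n : N.X ⊗ H.X ⟶ Q}

namespace IsTensor

theorem condition (hn : N.IsTensor n) : N.act ▷ H.X ≫ n = H.j _ ▷ H.X ≫ H.m _ ≫ n := by
  rw [hn.choose, phiL_eq, Category.assoc]

theorem actH_comp (hn : N.IsTensor n) : N.actH ▷ H.X ≫ n = H.L _ ▷ H.X ≫ H.m _ ≫ n := by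
  rw [actH, comp_whiskerRight, Category.assoc, hn.condition, ← comp_whiskerRight_assoc, k_j]

theorem epi (hn : N.IsTensor n) : Epi n := by
  obtain ⟨_, ⟨h⟩⟩ := hn
  exact epi_of_isColimit_cofork h

theorem exists_desc (hn : N.IsTensor n) {Y : C} (f : N.X ⊗ H.X ⟶ Y)
    (hf : N.act ▷ H.X ≫ f = H.j _ ▷ H.X ≫ H.m _ ≫ f) : ∃ f' : Q ⟶ Y, n ≫ f' = f := by
  obtain ⟨_, ⟨h⟩⟩ := hn
  have := Cofork.IsColimit.desc' h f (by rw [hf, phiL_eq, Category.assoc])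
  exact ⟨this.1, this.2⟩

/-- Left multiplication by H_L is right H-colinear (`L_m_d`), so the coaction descends to the
coequalizer. -/
theorem exists_coact (hn : N.IsTensor n) : ∃ r : Q ⟶ Q ⊗ H.X, n ≫ r = H.d _ ≫ n ▷ H.X := by
  apply hn.exists_desc
  symm
  calc _ = H.j _ ▷ H.X ≫ (H.L _ ▷ H.X ≫ H.m _ ≫ H.d _) ≫ n ▷ H.X := by
        nth_rw 1 [← H.j_L]; simp only [comp_whiskerRight, Category.assoc]
    _ = (H.j _ ≫ H.L _) ▷ H.X ≫ H.d _ ≫ H.m _ ▷ H.X ≫ n ▷ H.X := by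
        rw [L_m_d]; simp only [comp_whiskerRight, Category.assoc]
    _ = H.d _ ≫ (H.j _ ▷ H.X ≫ H.m _ ≫ n) ▷ H.X := by rw [j_L]; simp
    _ = _ := by rw [← hn.condition]; simp

variable [PreservesColimitsOfShape WalkingParallelPair (tensorRight H.X)]

theorem epi_whisker (hn : N.IsTensor n) : Epi (n ▷ H.X) := by
  obtain ⟨_, ⟨h⟩⟩ := hn
  exact epi_of_isColimit_cofork (isColimitCoforkMapOfIsColimit (tensorRight H.X) _ h)

theorem epi_whisker₂ (hn : N.IsTensor n) : Epi (n ▷ H.X ▷ H.X) := by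
  obtain ⟨_, ⟨h⟩⟩ := hn
  exact epi_of_isColimit_cofork (isColimitCoforkMapOfIsColimit (tensorRight H.X) _
    (isColimitCoforkMapOfIsColimit (tensorRight H.X) _ h))

/-- Since – ⊗ H preserves coequalizers, `n ▷ H.X` is again one, and z(hk) = (zh)k for z in H_L lets
the product descend. -/
theorem exists_act (hn : N.IsTensor n) : ∃ φ : Q ⊗ H.X ⟶ Q, n ▷ H.X ≫ φ = H.m _ ≫ n := by
  have hf : N.act ▷ H.X ▷ H.X ≫ H.m _ ≫ n =
      H.j _ ▷ H.X ▷ H.X ≫ H.m _ ▷ H.X ≫ H.m _ ≫ n := by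
    calc _ = H.m _ ≫ N.act ▷ H.X ≫ n := by simp
      _ = H.j _ ▷ H.X ▷ H.X ≫ H.m _ ≫ H.m _ ≫ n := by rw [hn.condition]; simp
      _ = H.j _ ▷ H.X ▷ H.X ≫ (H.L _ ▷ H.X ▷ H.X ≫ H.m _ ≫ H.m _) ≫ n := by
          nth_rw 1 [← H.j_L]; simp only [comp_whiskerRight, Category.assoc]
      _ = (H.j _ ≫ H.L _) ▷ H.X ▷ H.X ≫ H.m _ ▷ H.X ≫ H.m _ ≫ n := by
          rw [← L_m_m']; simp only [comp_whiskerRight, Category.assoc]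
      _ = _ := by rw [j_L]
  obtain ⟨_, ⟨h⟩⟩ := hn
  have := Cofork.IsColimit.desc' (isColimitCoforkMapOfIsColimit (tensorRight H.X) _ h)
    (H.m _ ≫ n) (by
      refine Eq.trans hf ?_
      simp [phiL_eq])
  exact ⟨this.1, this.2⟩

theorem exists_hopfModule (hn : N.IsTensor n) : ∃ (M : HopfModule H) (n' : N.X ⊗ H.X ⟶ M.X),
    N.IsTensor n' ∧ n' ▷ H.X ≫ M.act = H.m _ ≫ n' ∧ n' ≫ M.coact = H.d _ ≫ n' ▷ H.X := by
  obtain ⟨φ, hφ⟩ := hn.exists_act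
  obtain ⟨r, hr⟩ := hn.exists_coact
  have hφ' : n ▷ H.X ▷ H.X ≫ φ ▷ H.X = H.m _ ▷ H.X ≫ n ▷ H.X := by
    rw [← comp_whiskerRight, hφ, comp_whiskerRight]
  have hr' : n ▷ H.X ≫ r ▷ H.X = H.d _ ▷ H.X ≫ n ▷ H.X ▷ H.X := by
    rw [← comp_whiskerRight, hr, comp_whiskerRight]
  have := hn.epi
  have := hn.epi_whisker
  -- Every axiom is tested after the epimorphism `n` or `n ▷ H.X`, where it becomes an identity on N
  -- ⊗ H. The last one is h ⊗ k ↦ (hΠ^L(k₁))k₂ = h(Π^L(k₁)k₂) = hk.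
  refine ⟨HopfModule.ofNat Q φ r ?_ ?_ ?_ ?_ ?_ ?_ ?_, n, hn, hφ, hr⟩
  · rw [← cancel_epi n]
    simp [reassoc_of% hr, reassoc_of% H.d_e]
  · rw [← cancel_epi n]
    simp [reassoc_of% hr, hr', reassoc_of% H.d_d]
  · rw [← cancel_epi n]
    simp [hφ, reassoc_of% H.u_m']
  · rw [← cancel_epi (n ▷ H.X), reassoc_of% hφ, hr, reassoc_of% hr']
    simp [hφ', reassoc_of% H.m_d]
  · rw [← cancel_epi (n ▷ H.X)]
    simpa [reassoc_of% hφ', hφ] using congrArg (· ≫ n) (H.m_s_m N.X)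
  · rw [← cancel_epi (n ▷ H.X)]
    simp [reassoc_of% hφ', hφ, reassoc_of% H.s_m_m']
  · rw [← cancel_epi (n ▷ H.X)]
    calc _ = H.d _ ≫ (H.L _ ▷ H.X ≫ H.m _ ▷ H.X ≫ H.m _) ≫ n := by
          simp [reassoc_of% hφ', hφ]
      _ = H.m _ ≫ n := by
          rw [L_m_m]
          simp only [Category.assoc]
          rw [reassoc_of% H.d_L_m]
      _ = _ := hφ.symm

end IsTensor

end

section

variable [HasCoequalizers C] [PreservesColimitsOfShape WalkingParallelPair (tensorRight H.X)]
  (N : RightHLModule H)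

theorem exists_indHopfModule : ∃ (M : HopfModule H) (n : N.X ⊗ H.X ⟶ M.X),
    N.IsTensor n ∧ n ▷ H.X ≫ M.act = H.m _ ≫ n ∧ n ≫ M.coact = H.d _ ≫ n ▷ H.X :=
  N.exists_isTensor.choose_spec.choose_spec.exists_hopfModule

/-- The Hopf module `N ⊗_{H_L} H`. -/
noncomputable def ind : HopfModule H := N.exists_indHopfModule.choose

/-- The projection `N ⊗ H ⟶ N ⊗_{H_L} H`. -/
noncomputable def n : N.X ⊗ H.X ⟶ N.ind.X := N.exists_indHopfModule.choose_spec.choose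

theorem isTensor_n : N.IsTensor N.n := N.exists_indHopfModule.choose_spec.choose_spec.1

instance : Epi N.n := N.isTensor_n.epi

instance : Epi (N.n ▷ H.X) := N.isTensor_n.epi_whisker

instance : Epi (N.n ▷ H.X ▷ H.X) := N.isTensor_n.epi_whisker₂

@[simp]
theorem n_act : N.n ▷ H.X ≫ N.ind.act = H.m _ ≫ N.n :=
  N.exists_indHopfModule.choose_spec.choose_spec.2.1

@[simp]
theorem n_act_assoc {Z : C} (h : N.ind.X ⟶ Z) :
    N.n ▷ H.X ≫ N.ind.act ≫ h = H.m _ ≫ N.n ≫ h := by rw [reassoc_of% N.n_act]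

@[simp]
theorem whisker_n_act :
    N.n ▷ H.X ▷ H.X ≫ N.ind.act ▷ H.X = H.m _ ▷ H.X ≫ N.n ▷ H.X := by
  rw [← comp_whiskerRight, n_act, comp_whiskerRight]

@[simp]
theorem whisker_n_act_assoc {Z : C} (h : N.ind.X ⊗ H.X ⟶ Z) :
    N.n ▷ H.X ▷ H.X ≫ N.ind.act ▷ H.X ≫ h = H.m _ ▷ H.X ≫ N.n ▷ H.X ≫ h := by
  rw [reassoc_of% N.whisker_n_act]

@[simp]
theorem n_coact : N.n ≫ N.ind.coact = H.d _ ≫ N.n ▷ H.X :=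
  N.exists_indHopfModule.choose_spec.choose_spec.2.2

@[simp]
theorem n_coact_assoc {Z : C} (h : N.ind.X ⊗ H.X ⟶ Z) :
    N.n ≫ N.ind.coact ≫ h = H.d _ ≫ N.n ▷ H.X ≫ h := by rw [reassoc_of% N.n_coact]

@[simp]
theorem whisker_n_coact :
    N.n ▷ H.X ≫ N.ind.coact ▷ H.X = H.d _ ▷ H.X ≫ N.n ▷ H.X ▷ H.X := by
  rw [← comp_whiskerRight, n_coact, comp_whiskerRight]

@[simp]
theorem whisker_n_coact_assoc {Z : C} (h : (N.ind.X ⊗ H.X) ⊗ H.X ⟶ Z) :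
    N.n ▷ H.X ≫ N.ind.coact ▷ H.X ≫ h = H.d _ ▷ H.X ≫ N.n ▷ H.X ▷ H.X ≫ h := by
  rw [reassoc_of% N.whisker_n_coact]

theorem isStrong_ind : HopfModule.IsStrong H N.ind := by
  rw [HopfModule.isStrong_iff, ← cancel_epi (N.n ▷ H.X ▷ H.X)]
  calc _ = (H.L _ ▷ H.X ≫ H.m _ ▷ H.X ≫ H.m _) ≫ N.n := by simp
    _ = _ := by rw [L_m_m]; simp

/-- The morphism from `N ⊗_{H_L} H` induced by a balanced morphism from `N ⊗ H`. -/
noncomputable def desc {Y : C} (f : N.X ⊗ H.X ⟶ Y)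
    (hf : N.act ▷ H.X ≫ f = H.j _ ▷ H.X ≫ H.m _ ≫ f) : N.ind.X ⟶ Y :=
  (N.isTensor_n.exists_desc f hf).choose

theorem n_desc {Y : C} (f : N.X ⊗ H.X ⟶ Y)
    (hf : N.act ▷ H.X ≫ f = H.j _ ▷ H.X ≫ H.m _ ≫ f) : N.n ≫ N.desc f hf = f :=
  (N.isTensor_n.exists_desc f hf).choose_spec

theorem n_q : N.n ≫ N.ind.q = H.L _ ≫ N.n := by
  simp [HopfModule.q_eq, L_eq]

/-- Since q(n ⊗ h) = n ⊗ Π^L(h), the transported action gives n ⊗ Π^L(h₁)(h₂k) = n ⊗ (Π^L(h₁)h₂)k =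
n ⊗ hk. -/
theorem ind_actAlpha : N.ind.actAlpha = N.ind.act := by
  rw [← cancel_epi (N.n ▷ H.X), HopfModule.actAlpha_eq]
  calc _ = H.d _ ▷ H.X ≫ H.m _ ≫ (N.n ≫ N.ind.q) ▷ H.X ≫ N.ind.act := by simp
    _ = H.d _ ▷ H.X ≫ (H.L _ ▷ H.X ▷ H.X ≫ H.m _ ≫ H.m _) ≫ N.n := by rw [n_q]; simp
    _ = (H.d _ ≫ H.L _ ▷ H.X ≫ H.m _) ▷ H.X ≫ H.m _ ≫ N.n := by rw [← L_m_m']; simp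
    _ = _ := by rw [d_L_m]; simp

variable {N} {P : RightHLModule H} (f : N ⟶ P)

/-- The morphism `f ⊗_{H_L} H`. -/
noncomputable def indMap : N.ind.X ⟶ P.ind.X :=
  N.desc (f.hom ▷ H.X ≫ P.n) (by
    rw [← comp_whiskerRight_assoc, ← f.linear, comp_whiskerRight, Category.assoc,
      P.isTensor_n.condition, ← comp_whiskerRight_assoc, j_nat]
    simp)

@[simp]
theorem n_indMap : N.n ≫ indMap f = f.hom ▷ H.X ≫ P.n := N.n_desc _ _

@[simp]
theorem n_indMap_assoc {Z : C} (h : P.ind.X ⟶ Z) :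
    N.n ≫ indMap f ≫ h = f.hom ▷ H.X ≫ P.n ≫ h := by rw [reassoc_of% n_indMap f]

@[simp]
theorem whisker_n_indMap :
    N.n ▷ H.X ≫ indMap f ▷ H.X = f.hom ▷ H.X ▷ H.X ≫ P.n ▷ H.X := by
  rw [← comp_whiskerRight, n_indMap, comp_whiskerRight]

@[simp]
theorem whisker_n_indMap_assoc {Z : C} (h : P.ind.X ⊗ H.X ⟶ Z) :
    N.n ▷ H.X ≫ indMap f ▷ H.X ≫ h = f.hom ▷ H.X ▷ H.X ≫ P.n ▷ H.X ≫ h := by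
  rw [reassoc_of% whisker_n_indMap f]

/-- The morphism `f ⊗_{H_L} H` of Hopf modules. -/
noncomputable def indHom : N.ind ⟶ P.ind where
  hom := indMap f
  colinear := by
    rw [← cancel_epi N.n]
    simp
  quasilinear := by
    rw [ind_actAlpha, ind_actAlpha, ← cancel_epi (N.n ▷ H.X)]
    simp

variable (H) in
/-- The induction functor `- ⊗_{H_L} H`. -/
noncomputable def induction : RightHLModule H ⥤ StrongHopfModule H where
  obj N := ⟨N.ind, N.isStrong_ind⟩
  map f := ObjectProperty.homMk (indHom f)
  map_id N := by
    apply ObjectProperty.hom_ext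
    apply HopfModule.Hom.ext
    change indMap (𝟙 N) = 𝟙 N.ind.X
    rw [← cancel_epi N.n, n_indMap]
    change 𝟙 N.X ▷ H.X ≫ _ = _
    simp
  map_comp {N P Q} f f' := by
    apply ObjectProperty.hom_ext
    apply HopfModule.Hom.ext
    change indMap (f ≫ f') = indMap f ≫ indMap f'
    rw [← cancel_epi N.n, n_indMap]
    change (f.hom ≫ f'.hom) ▷ H.X ≫ _ = _
    simp

theorem isInductionFunctor_induction : IsInductionFunctor (induction H) where
  exists_coequalizer := by
    refine ⟨fun N => N.n, fun N => ⟨N.isTensor_n, ?_, ?_⟩, ?_⟩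
    · exact N.n_act.trans (Category.assoc _ _ _)
    · exact N.n_coact.trans (Category.assoc _ _ _)
    · intro N P f
      exact n_indMap f

end

end RightHLModule

/-! ### The unit and product of H_L, seen inside H. -/

namespace WeakHopfQuasigroup

variable {C : Type u} [Category.{v} C] [MonoidalCategory C] [BraidedCategory C]
variable (H : WeakHopfQuasigroup C) (X : C)

/-- For z in H_L the product zΠ^L(k) is ε(z₁k)z₂, and z₂ stays in H_L. So H_L is closed under the
product and the projection in `mulL` loses nothing. -/
theorem L_L_m_L : H.L _ ≫ H.L X ▷ H.X ≫ H.m X ≫ H.L X = H.L _ ≫ H.L X ▷ H.X ≫ H.m X := by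
  calc _ = H.L X ▷ H.X ≫ (H.L _ ≫ H.m X) ≫ H.L X := by simp
    _ = (H.L X ≫ H.d X) ▷ H.X ≫ (H.b _ ≫ H.L _) ≫ H.me X ▷ H.X := by rw [L_m]; simp
    _ = (H.L X ≫ H.d X ≫ H.L _) ▷ H.X ≫ H.b _ ≫ H.me X ▷ H.X := by rw [b_L]; simp
    _ = H.L X ▷ H.X ≫ H.L _ ≫ H.m X := by rw [L_d_L, L_m]; simp
    _ = _ := by simp

variable [IsIdempotentComplete C]

theorem oneL_j : X ◁ H.oneL ≫ H.j X = (ρ_ X).hom ≫ H.u X := by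
  calc _ = X ◁ H.one ≫ H.L X := by
        rw [oneL, j, ← MonoidalCategory.whiskerLeft_comp, Category.assoc, pL_iL,
          MonoidalCategory.whiskerLeft_comp, L]
    _ = (ρ_ X).hom ≫ H.u X ≫ H.L X := by simp [u]
    _ = _ := by rw [u_L]

theorem mulL_j : X ◁ H.mulL ≫ H.j X = (α_ _ _ _).inv ≫ H.j X ▷ H.HL ≫ H.j _ ≫ H.m X := by
  calc _ = (α_ _ _ _).inv ≫ H.j X ▷ H.HL ≫ H.j _ ≫ H.m X ≫ H.k X ≫ H.j X := by
        simp only [j, m, k, mulL, MonoidalCategory.tensorHom_def]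
        monoidal
    _ = (α_ _ _ _).inv ≫ H.j _ ≫ H.j X ▷ H.X ≫ H.m X ≫ H.L X := by
        rw [k_j, reassoc_of% H.j_nat]
    _ = (α_ _ _ _).inv ≫ H.j _ ≫ H.j X ▷ H.X ≫ H.L _ ≫ H.L X ▷ H.X ≫ H.m X ≫ H.L X := by
        rw [L_nat_assoc, reassoc_of% H.j_L, ← comp_whiskerRight_assoc, j_L]
    _ = (α_ _ _ _).inv ≫ H.j _ ≫ H.j X ▷ H.X ≫ H.m X := by
        rw [L_L_m_L, L_nat_assoc, reassoc_of% H.j_L, ← comp_whiskerRight_assoc, j_L]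
    _ = _ := by rw [reassoc_of% H.j_nat]

end WeakHopfQuasigroup

/-! ### Restriction of morphisms and of the action to coinvariants. -/

namespace HopfModule

open WeakHopfQuasigroup

variable {C : Type u} [Category.{v} C] [MonoidalCategory C] [BraidedCategory C]
  [IsIdempotentComplete C] {H : WeakHopfQuasigroup C}

theorem Hom.comp_q {M T : HopfModule H} (f : M ⟶ T) : f.hom ≫ T.q = M.q ≫ f.hom := by
  rw [← coact_s_actAlpha, reassoc_of% f.colinear, s_nat_assoc, f.quasilinear, ← coact_s_actAlpha]
  simp only [Category.assoc]

theorem IsCoinv.comp_hom {M T : HopfModule H} {Z : C} {f : Z ⟶ M.X} (hf : M.IsCoinv f)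
    (t : M ⟶ T) : T.IsCoinv (f ≫ t.hom) :=
  isCoinv_of_comp_q (by rw [Category.assoc, t.comp_q, reassoc_of% hf.comp_q])

/-- Morphisms need not respect φ in general; they do on coinvariants, where φ and the transported
action agree on both sides. -/
theorem IsCoinv.act_hom {M T : HopfModule H} {Z : C} {f : Z ⟶ M.X} (hf : M.IsCoinv f)
    (hM : IsStrong H M) (hT : IsStrong H T) (t : M ⟶ T) :
    f ▷ H.X ≫ M.act ≫ t.hom = (f ≫ t.hom) ▷ H.X ≫ T.act := by
  rw [← (hf.comp_hom t).actAlpha hT, ← reassoc_of% hf.actAlpha hM, ← t.quasilinear,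
    comp_whiskerRight, Category.assoc]

theorem IsCoinv.j_act {M : HopfModule H} {Z : C} {f : Z ⟶ M.X} (hf : M.IsCoinv f) :
    M.IsCoinv (f ▷ H.HL ≫ H.j _ ≫ M.act) := by
  have h : f ▷ H.HL ≫ H.j _ ≫ M.act = H.j _ ≫ f ▷ H.X ≫ H.L _ ≫ M.act := by
    rw [L_nat_assoc, reassoc_of% H.j_L, reassoc_of% H.j_nat]
  rw [h]
  simpa [IsCoinv] using congrArg (H.j _ ≫ ·) hf.act

theorem isStrong_iff_j {M : HopfModule H} : IsStrong H M ↔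
    H.j _ ▷ H.X ≫ M.act ▷ H.X ≫ M.act = H.j _ ▷ H.X ≫ H.m _ ≫ M.act := by
  rw [isStrong_iff, whisker_L_comp_eq_iff]

theorem exists_co (M : HopfModule H) (hM : IsStrong H M) :
    ∃ (N : RightHLModule H) (p : M.X ⟶ N.X) (i : N.X ⟶ M.X),
      p ≫ i = M.q ∧ i ≫ p = 𝟙 _ ∧ N.act = (i ⊗ₘ H.iL) ≫ M.act ≫ p := by
  -- nz is already coinvariant, so projecting and including again changes nothing. As `M.i` is
  -- monic, the module axioms can be checked inside M, where strongness supplies associativity.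
  have h : ((M.i ⊗ₘ H.iL) ≫ M.act ≫ M.p) ≫ M.i = M.i ▷ H.HL ≫ H.j _ ≫ M.act := by
    have := M.isCoinv_i.j_act.comp_q
    simp only [Category.assoc] at this
    rw [Category.assoc, Category.assoc, p_i, MonoidalCategory.tensorHom_def, Category.assoc]
    exact this
  have hi : Mono M.i := mono_of_mono_fac M.i_p
  refine ⟨⟨M.coinv, (M.i ⊗ₘ H.iL) ≫ M.act ≫ M.p, ?_, ?_⟩, M.p, M.i, M.p_i, M.i_p, rfl⟩
  · rw [← cancel_mono M.i, Category.assoc, h, whisker_exchange_assoc, reassoc_of% H.oneL_j,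
      u_act, Category.comp_id, rightUnitor_naturality]
  · generalize (M.i ⊗ₘ H.iL) ≫ M.act ≫ M.p = A at h ⊢
    have hj := isStrong_iff_j.1 hM
    rw [← cancel_mono M.i, Category.assoc, Category.assoc, Category.assoc, h,
      ← comp_whiskerRight_assoc, h]
    calc _ = M.i ▷ _ ≫ M.X ◁ H.mulL ≫ H.j _ ≫ M.act := by simp [whisker_exchange_assoc]
      _ = _ := by
        rw [reassoc_of% H.mulL_j, reassoc_of% H.j_nat, ← hj, ← reassoc_of% H.j_nat,
          ← reassoc_of% H.j_nat]
        simp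
end HopfModule

/-! ### The coinvariants functor and the counit. -/

namespace StrongHopfModule

open WeakHopfQuasigroup HopfModule

variable {C : Type u} [Category.{v} C] [MonoidalCategory C] [BraidedCategory C]
  [IsIdempotentComplete C] {H : WeakHopfQuasigroup C} (M : StrongHopfModule H)

/-- The `H_L`-module of coinvariants. -/
noncomputable def co : RightHLModule H := (M.obj.exists_co M.property).choose

/-- The projection onto the coinvariants. -/
noncomputable def p : M.obj.X ⟶ M.co.X := (M.obj.exists_co M.property).choose_spec.choose

/-- The inclusion of the coinvariants. -/
noncomputable def i : M.co.X ⟶ M.obj.X :=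
  (M.obj.exists_co M.property).choose_spec.choose_spec.choose

theorem p_i : M.p ≫ M.i = M.obj.q :=
  (M.obj.exists_co M.property).choose_spec.choose_spec.choose_spec.1

theorem i_p : M.i ≫ M.p = 𝟙 _ :=
  (M.obj.exists_co M.property).choose_spec.choose_spec.choose_spec.2.1

theorem co_act : M.co.act = (M.i ⊗ₘ H.iL) ≫ M.obj.act ≫ M.p :=
  (M.obj.exists_co M.property).choose_spec.choose_spec.choose_spec.2.2

instance : Mono M.i := mono_of_mono_fac M.i_p

theorem i_q : M.i ≫ M.obj.q = M.i := by rw [← M.p_i, reassoc_of% M.i_p]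

theorem isCoinv_i : M.obj.IsCoinv M.i := isCoinv_of_comp_q M.i_q

theorem co_act_eq : M.co.act = M.i ▷ H.HL ≫ H.j _ ≫ M.obj.act ≫ M.p := by
  rw [co_act, MonoidalCategory.tensorHom_def, Category.assoc]
  rfl

theorem co_act_i : M.co.act ≫ M.i = M.i ▷ H.HL ≫ H.j _ ≫ M.obj.act := by
  have := M.isCoinv_i.j_act.comp_q
  simp only [Category.assoc] at this
  rw [co_act_eq, Category.assoc, Category.assoc, Category.assoc, p_i, this]

theorem i_act_p : M.i ▷ H.X ≫ M.obj.act ≫ M.p = M.co.actH := by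
  have h : M.obj.q ≫ M.p = M.p := by rw [← p_i, Category.assoc, i_p, Category.comp_id]
  rw [← h, reassoc_of% M.isCoinv_i.act_q, RightHLModule.actH, co_act_eq, ← k_j,
    ← reassoc_of% H.k_nat]
  simp only [Category.assoc]

variable {M}

/-- The restriction of a morphism to the coinvariants. -/
noncomputable def coMap {T : StrongHopfModule H} (f : M ⟶ T) : M.co.X ⟶ T.co.X :=
  M.i ≫ f.hom.hom ≫ T.p

theorem coMap_i {T : StrongHopfModule H} (f : M ⟶ T) : coMap f ≫ T.i = M.i ≫ f.hom.hom := by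
  rw [coMap, Category.assoc, Category.assoc, p_i, f.hom.comp_q, reassoc_of% M.i_q]

/-- The restriction of a morphism to the coinvariants, as a morphism of `H_L`-modules. -/
noncomputable def coHom {T : StrongHopfModule H} (f : M ⟶ T) : M.co ⟶ T.co where
  hom := coMap f
  linear := by
    rw [← cancel_mono T.i, Category.assoc, Category.assoc, co_act_i, coMap_i,
      ← comp_whiskerRight_assoc, coMap_i, reassoc_of% M.co_act_i, reassoc_of% H.j_nat,
      ← M.isCoinv_i.act_hom M.property T.property, reassoc_of% H.j_nat]

variable (H) in
/-- The functor of coinvariants. -/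
noncomputable def coinvariants : StrongHopfModule H ⥤ RightHLModule H where
  obj M := M.co
  map f := coHom f
  map_id M := by
    apply RightHLModule.Hom.ext
    change coMap (𝟙 M) = 𝟙 _
    rw [← cancel_mono M.i, coMap_i]
    change M.i ≫ 𝟙 _ = _
    simp
  map_comp {M T S} f g := by
    apply RightHLModule.Hom.ext
    change coMap (f ≫ g) = coMap f ≫ coMap g
    rw [← cancel_mono S.i, coMap_i, Category.assoc, coMap_i, reassoc_of% coMap_i f]
    rfl

theorem isCoinvariantsFunctor_coinvariants : IsCoinvariantsFunctor (coinvariants H) where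
  exists_image := ⟨fun M => M.p, fun M => M.i, fun M => ⟨M.p_i, M.i_p, M.co_act⟩,
    fun _ _ g => coMap_i g⟩

variable [HasCoequalizers C] [PreservesColimitsOfShape WalkingParallelPair (tensorRight H.X)]

variable (M)

/-- The counit `n ⊗ h ↦ n h`. -/
noncomputable def counitMap : M.co.ind.X ⟶ M.obj.X :=
  M.co.desc (M.i ▷ H.X ≫ M.obj.act) (by
    have h := isStrong_iff_j.1 M.property
    calc _ = (M.co.act ≫ M.i) ▷ H.X ≫ M.obj.act := by simp
      _ = M.i ▷ H.HL ▷ H.X ≫ H.j _ ▷ H.X ≫ M.obj.act ▷ H.X ≫ M.obj.act := by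
          rw [co_act_i]; simp
      _ = (M.i ▷ H.HL ≫ H.j _) ▷ H.X ≫ H.m _ ≫ M.obj.act := by rw [h]; simp
      _ = _ := by rw [j_nat]; simp)

theorem n_counitMap : M.co.n ≫ M.counitMap = M.i ▷ H.X ≫ M.obj.act := M.co.n_desc _ _

/-- The composite sends n ⊗ h to p(nh₁) ⊗ h₂ = n p_L(h₁) ⊗ h₂ = n ⊗ Π^L(h₁)h₂. -/
theorem counitMap_hom_inv :
    M.counitMap ≫ M.obj.coact ≫ M.p ▷ H.X ≫ M.co.n = 𝟙 _ := by
  rw [← cancel_epi M.co.n, reassoc_of% M.n_counitMap]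
  calc _ = (M.i ▷ H.X ≫ M.obj.act ≫ M.obj.coact) ≫ M.p ▷ H.X ≫ M.co.n := by simp
    _ = H.d _ ≫ (M.i ▷ H.X ≫ M.obj.act ≫ M.p) ▷ H.X ≫ M.co.n := by
        rw [M.isCoinv_i.act_coact]; simp
    _ = (H.d _ ≫ H.L _ ▷ H.X ≫ H.m _) ≫ M.co.n := by
        rw [i_act_p, M.co.isTensor_n.actH_comp]; simp only [Category.assoc]
    _ = _ := by rw [d_L_m]; simp

theorem counitMap_inv_hom :
    (M.obj.coact ≫ M.p ▷ H.X ≫ M.co.n) ≫ M.counitMap = 𝟙 _ := by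
  simp only [Category.assoc]
  rw [n_counitMap, ← comp_whiskerRight_assoc, p_i, coact_q_act]

theorem counitMap_colinear :
    M.counitMap ≫ M.obj.coact = M.co.ind.coact ≫ M.counitMap ▷ H.X := by
  rw [← cancel_epi M.co.n, reassoc_of% M.n_counitMap, M.isCoinv_i.act_coact,
    M.co.n_coact_assoc, ← comp_whiskerRight, n_counitMap]
  simp

/-- On n ⊗ h ⊗ k the left side is q(nh₁)(h₂k) = (nΠ^L(h₁))(h₂k). Strongness and then `L_m_m'`
rebracket it to n((Π^L(h₁)h₂)k) = n(hk). -/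
theorem counitMap_quasilinear :
    M.counitMap ▷ H.X ≫ M.obj.actAlpha = M.co.ind.actAlpha ≫ M.counitMap := by
  rw [← cancel_epi (M.co.n ▷ H.X), RightHLModule.ind_actAlpha, M.co.n_act_assoc,
    n_counitMap, ← comp_whiskerRight_assoc, n_counitMap, actAlpha_eq]
  have h := (isStrong_iff (M := M.obj)).1 M.property
  calc _ = (M.i ▷ H.X ≫ M.obj.act ≫ M.obj.coact) ▷ H.X ≫ H.m _ ≫ M.obj.q ▷ H.X ≫ M.obj.act := by
        simp
    _ = H.d _ ▷ H.X ≫ H.m _ ≫ (M.i ▷ H.X ≫ M.obj.act ≫ M.obj.q) ▷ H.X ≫ M.obj.act := by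
        rw [M.isCoinv_i.act_coact]; simp
    _ = H.d _ ▷ H.X ≫ H.m _ ≫ M.i ▷ H.X ▷ H.X ≫ H.L _ ▷ H.X ≫ M.obj.act ▷ H.X ≫ M.obj.act := by
        rw [M.isCoinv_i.act_q]; simp
    _ = H.d _ ▷ H.X ≫ (H.L _ ▷ H.X ▷ H.X ≫ H.m _ ≫ H.m _) ≫ M.i ▷ H.X ≫ M.obj.act := by
        rw [h]; simp
    _ = (H.d _ ≫ H.L _ ▷ H.X ≫ H.m _) ▷ H.X ≫ H.m _ ≫ M.i ▷ H.X ≫ M.obj.act := by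
        rw [← L_m_m']; simp
    _ = _ := by rw [d_L_m]; simp

end StrongHopfModule

namespace HopfModule

variable {C : Type u} [Category.{v} C] [MonoidalCategory C] [BraidedCategory C]
  [IsIdempotentComplete C] {H : WeakHopfQuasigroup C}

/-- An isomorphism of Hopf modules, from an isomorphism of the underlying objects. -/
def isoMk {M T : HopfModule H} (f : M ⟶ T) (f' : T.X ⟶ M.X) (h : f.hom ≫ f' = 𝟙 _)
    (h' : f' ≫ f.hom = 𝟙 _) : M ≅ T where
  hom := f
  inv :=
    { hom := f'
      colinear := by
        calc _ = f' ≫ M.coact ≫ (f.hom ≫ f') ▷ H.X := by rw [h]; simp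
          _ = f' ≫ (M.coact ≫ f.hom ▷ H.X) ≫ f' ▷ H.X := by simp
          _ = _ := by rw [← f.colinear, Category.assoc, reassoc_of% h']
      quasilinear := by
        calc _ = f' ▷ H.X ≫ (M.actAlpha ≫ f.hom) ≫ f' := by simp [h]
          _ = (f' ≫ f.hom) ▷ H.X ≫ T.actAlpha ≫ f' := by rw [← f.quasilinear]; simp
          _ = _ := by rw [h']; simp }
  hom_inv_id := Hom.ext h
  inv_hom_id := Hom.ext h'

end HopfModule

/-! ### The unit and the natural isomorphisms. -/

namespace RightHLModule

open WeakHopfQuasigroup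

variable {C : Type u} [Category.{v} C] [MonoidalCategory C] [BraidedCategory C]
  [IsIdempotentComplete C] {H : WeakHopfQuasigroup C}

/-- An isomorphism of `H_L`-modules, from an isomorphism of the underlying objects. -/
def isoMk {N P : RightHLModule H} (f : N ⟶ P) (f' : P.X ⟶ N.X) (h : f.hom ≫ f' = 𝟙 _)
    (h' : f' ≫ f.hom = 𝟙 _) : N ≅ P where
  hom := f
  inv :=
    { hom := f'
      linear := by
        calc _ = f' ▷ H.HL ≫ (N.act ≫ f.hom) ≫ f' := by simp [h]
          _ = (f' ≫ f.hom) ▷ H.HL ≫ P.act ≫ f' := by rw [← f.linear]; simp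
          _ = _ := by rw [h']; simp }
  hom_inv_id := Hom.ext h
  inv_hom_id := Hom.ext h'

variable [HasCoequalizers C] [PreservesColimitsOfShape WalkingParallelPair (tensorRight H.X)]
variable (N : RightHLModule H)

/-- The strong Hopf module `N ⊗_{H_L} H`. -/
noncomputable abbrev indStrong : StrongHopfModule H := ⟨N.ind, N.isStrong_ind⟩

/-- The unit `n ↦ n ⊗ 1`. -/
noncomputable def unitMap : N.X ⟶ N.indStrong.co.X := H.u _ ≫ N.n ≫ N.indStrong.p

theorem unitMap_i : N.unitMap ≫ N.indStrong.i = H.u _ ≫ N.n := by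
  rw [unitMap, Category.assoc, Category.assoc, StrongHopfModule.p_i, n_q, reassoc_of% H.u_L]

/-- In N ⊗_{H_L} H one has (n ⊗ 1)z = n ⊗ z = n ⊗ z1 = nz ⊗ 1. -/
theorem unitMap_linear : N.unitMap ▷ H.HL ≫ N.indStrong.co.act = N.act ≫ N.unitMap := by
  rw [← cancel_mono N.indStrong.i, Category.assoc, Category.assoc, StrongHopfModule.co_act_i,
    unitMap_i, ← comp_whiskerRight_assoc, unitMap_i, reassoc_of% H.j_nat]
  calc _ = H.j _ ≫ H.u _ ▷ H.X ≫ N.n ▷ H.X ≫ N.ind.act := by simp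
    _ = H.j _ ≫ (H.u _ ▷ H.X ≫ H.m _) ≫ N.n := by simp
    _ = H.j _ ≫ (H.u _ ≫ H.m _) ≫ N.n := by rw [u_m, u_m']
    _ = H.u _ ≫ H.j _ ▷ H.X ≫ H.m _ ≫ N.n := by simp
    _ = _ := by rw [← N.isTensor_n.condition]; simp

/-- The morphism `n ⊗ h ↦ n p_L(h)`. -/
noncomputable def unitInv : N.ind.X ⟶ N.X := N.desc N.actH N.act_actH

theorem n_unitInv : N.n ≫ N.unitInv = N.actH := N.n_desc _ _

theorem unitMap_hom_inv : N.unitMap ≫ N.indStrong.i ≫ N.unitInv = 𝟙 _ := by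
  rw [reassoc_of% N.unitMap_i, n_unitInv, u_actH]

theorem unitMap_inv_hom : (N.indStrong.i ≫ N.unitInv) ≫ N.unitMap = 𝟙 _ := by
  -- n p_L(h) ⊗ 1 = n ⊗ Π^L(h)1 = q(n ⊗ h), and q is the identity on coinvariants.
  have h : N.unitInv ≫ H.u _ ≫ N.n = N.ind.q := by
    rw [← cancel_epi N.n, reassoc_of% N.n_unitInv, n_q]
    calc _ = H.u _ ≫ N.actH ▷ H.X ≫ N.n := by simp
      _ = H.L _ ≫ (H.u _ ≫ H.m _) ≫ N.n := by rw [N.isTensor_n.actH_comp]; simp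
      _ = _ := by rw [u_m']; simp
  rw [← cancel_mono N.indStrong.i, Category.assoc, Category.assoc, unitMap_i, h,
    StrongHopfModule.i_q, Category.id_comp]

variable (H)

/-- The unit of the equivalence between `H_L`-modules and strong Hopf modules. -/
noncomputable def unitNatIso : 𝟭 (RightHLModule H) ≅
    induction H ⋙ StrongHopfModule.coinvariants H :=
  NatIso.ofComponents
    (fun N => isoMk (P := N.indStrong.co) ⟨N.unitMap, N.unitMap_linear⟩ _ N.unitMap_hom_inv
      N.unitMap_inv_hom)
    (fun {N P} f => by
      apply Hom.ext
      change f.hom ≫ P.unitMap = N.unitMap ≫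
        StrongHopfModule.coMap (M := N.indStrong) (T := P.indStrong) 
        (ObjectProperty.homMk (indHom f) : N.indStrong ⟶ P.indStrong)
      rw [← cancel_mono P.indStrong.i, Category.assoc, Category.assoc, unitMap_i,
        StrongHopfModule.coMap_i, reassoc_of% N.unitMap_i]
      change _ = H.u _ ≫ N.n ≫ indMap f
      simp)

/-- The counit of the equivalence between `H_L`-modules and strong Hopf modules. -/
noncomputable def counitNatIso :
    StrongHopfModule.coinvariants H ⋙ induction H ≅ 𝟭 (StrongHopfModule H) :=
  NatIso.ofComponents
    (fun M => ObjectProperty.isoMk _ (HopfModule.isoMk (M := M.co.ind) (T := M.obj)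
      ⟨M.counitMap, M.counitMap_colinear, M.counitMap_quasilinear⟩ _ M.counitMap_hom_inv
      M.counitMap_inv_hom))
    (fun {M T} f => by
      apply ObjectProperty.hom_ext
      apply HopfModule.Hom.ext
      change indMap (StrongHopfModule.coHom f) ≫ T.counitMap = M.counitMap ≫ f.hom.hom
      rw [← cancel_epi M.co.n, n_indMap_assoc, T.n_counitMap, reassoc_of% M.n_counitMap]
      change StrongHopfModule.coMap f ▷ H.X ≫ _ = _
      rw [← comp_whiskerRight_assoc, StrongHopfModule.coMap_i,
        M.isCoinv_i.act_hom M.property T.property])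

end RightHLModule

theorem theorem3p10 {C : Type u} [Category.{v} C] [MonoidalCategory C] [BraidedCategory C]
    [IsIdempotentComplete C] [HasCoequalizers C] (H : WeakHopfQuasigroup C)
    [PreservesColimitsOfShape WalkingParallelPair (tensorRight H.X)] :
    ∃ (F : RightHLModule H ⥤ StrongHopfModule H) (G : StrongHopfModule H ⥤ RightHLModule H)
      (adj : F ⊣ G),
      IsInductionFunctor F ∧ IsCoinvariantsFunctor G ∧
        IsIso adj.unit ∧ IsIso adj.counit ∧ F.IsEquivalence := by
  -- No triangle identity is checked by hand: `Equivalence.mk` keeps the counit and corrects the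
  -- unit isomorphism so that the pair forms an adjunction.
  let e := CategoryTheory.Equivalence.mk _ _ (RightHLModule.unitNatIso H)
    (RightHLModule.counitNatIso H)
  refine ⟨_, _, e.toAdjunction, RightHLModule.isInductionFunctor_induction,
    StrongHopfModule.isCoinvariantsFunctor_coinvariants, ?_, ?_, ?_⟩
  · exact inferInstanceAs (IsIso e.unitIso.hom)
  · exact inferInstanceAs (IsIso e.counitIso.hom)
  · exact e.isEquivalence_functor
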